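/- Let $0<\alpha<\tfrac12$, $n>0$, let $\Phi$ be the standard normal distribution function and $z_\beta=\Phi^{-1}(1-\beta)$. Consider either the white noise model $dY(t)=f(t)\,dt+n^{-1/2}\,dW(t)$, $-\tfrac12\le t\le\tfrac12$, with $W$ a standard Brownian motion and $f$ an integrable function, or the Gaussian sequence model $Y(i)=f(i)+n^{-1/2}z_i$, $i\in M$, with $M$ finite or countably infinite and $z_i$ i.i.d. standard normal. Write $P_f,E_f,\mathrm{Var}_f$ for probability, expectation and variance under $f$, and $\|\cdot\|_2$ for the $L_2(-\frac12,\frac12)$ norm, respectively the $\ell_2$ norm over $M$. Let $T$ be a linear functional, let $\mathcal F_1,\dots,\mathcal F_k$ be convex sets of functions $f$ with $\mathcal F_i\cap\mathcal F_l\neq\emptyset$ for all $i,l$, and put $\mathcal G=\bigcup_{i=1}^k\mathcal F_i$. For sets $\mathcal A,\mathcal B$ of functions let $\omega(\varepsilon,\mathcal A,\mathcal B)=\sup\{Tg-Tf:\ \|g-f\|_2\le\varepsilon,\ f\in\mathcal A,\ g\in\mathcal B\}$, and let $\omega_{i,l}=\omega(z_{\alpha/2}/\sqrt n,\mathcal F_i,\mathcal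 F_l)$. Let $\mathcal I_{\alpha,\mathcal G}$ be the set of all confidence intervals $CI=CI(Y)$ with $P_f(Tf\in CI)\ge 1-\alpha$ for every $f\in\mathcal G$. For a confidence interval $CI$ with length $L(CI)$ let $L(CI,\mathcal F)=\sup_{f\in\mathcal F}E_f L(CI)$, and let $L^*_\alpha(\mathcal F,\mathcal G)=\inf_{CI\in\mathcal I_{\alpha,\mathcal G}}L(CI,\mathcal F)$. Fix $j\in\{1,\dots,k\}$ and suppose that $\omega_{i,j}$ and $\omega_{j,i}$ are finite for all $i$. For each pair $(i,l)$ with $i=j$ or $l=j$, let $\hat T_{i,l}$ be a linear estimator (a constant plus a finite linear combination of the data, or a mean-square limit of such) with $$\mathrm{Var}_f(\hat T_{i,l})\le \frac{\omega_{i,l}^2}{z_{\alpha/2}^2}\ (f\in\mathcal G),\qquad \inf_{f\in\mathcal F_l}\bigl(E_f\hat T_{i,l}-Tf\bigr)\ge-\tfrac12\omega_{i,l},\qquad \sup_{f\in\mathcal F_i}\bigl(E_f\hat T_{i,l}-Tf\bigr)\le\tfrac12\omega_{i,l},$$ and let $$CI^*_{j,\alpha}=\Bigl[\min_{1\le i\le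 k}\bigl\{\hat T_{i,j}-\tfrac32\omega_{i,j}\bigr\},\ \max_{1\le i\le k}\bigl\{\hat T_{j,i}+\tfrac32\omega_{j,i}\bigr\}\Bigr].$$ Then $CI^*_{j,\alpha}\in\mathcal I_{\alpha,\mathcal G}$, and $$L^*_\alpha(\mathcal F_j,\mathcal G)\ \le\ L(CI^*_{j,\alpha},\mathcal F_j)\ \le\ \frac{8\sqrt{\log(k+1)}+4z_{\alpha/2}}{(1/2-\alpha)\,z_\alpha}\;L^*_\alpha(\mathcal F_j,\mathcal G).$$ -/

import Mathlib

open MeasureTheory ProbabilityTheory Filter Topology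
open scoped ENNReal NNReal

noncomputable section

/-- The upper normal quantile `z_α = Φ⁻¹(1 - α)`, where `Φ` is the standard normal
cumulative distribution function. -/
def normalQuantile (α : ℝ) : ℝ :=
  sInf {x : ℝ | 1 - α ≤ cdf (gaussianReal 0 1) x}

/-! ### The two Gaussian models

In both models the unknown `f` and the data `Y` are real functions on the same index set `S`:
a time interval for white noise, a countable set for the sequence model. A model is given by the
laws of `Y` under the various `f`, as measures on the product space `S → ℝ`, and by the
`L²` (respectively `ℓ²`) norm, with the value `∞` outside `L²` (respectively `ℓ²`). The functional
`T` is any linear functional, continuous or not. It is taken to be defined on all functions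
`S → ℝ`; this loses nothing, since a linear functional on a subspace always extends linearly. -/

/-- The time interval `[-1/2, 1/2]`. -/
abbrev TimeInterval : Type := Set.Icc (-(1 / 2) : ℝ) (1 / 2)

/-- Lebesgue measure on `[-1/2, 1/2]`. -/
def timeMeasure : Measure TimeInterval := (volume : Measure ℝ).comap Subtype.val

/-- The path `Y(t) = ∫_{-1/2}^t f(s) ds + n^{-1/2} (W(t) - W(-1/2))`, `-1/2 ≤ t ≤ 1/2`, of the
white noise model `dY(t) = f(t) dt + n^{-1/2} dW(t)`. The Brownian motion `W` has its time
origin at `-1/2`. -/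
def whiteNoisePath {Ω : Type*} (n : ℝ) (W : ℝ≥0 → Ω → ℝ) (f : TimeInterval → ℝ) (ω : Ω) :
    TimeInterval → ℝ :=
  fun t => (∫ s in Set.Iic t, f s ∂timeMeasure) + (√n)⁻¹ * W (Real.toNNReal ((t : ℝ) + 1 / 2)) ω

/-- The law of the data in the white noise model with drift `f`. -/
def whiteNoiseLaw {Ω : Type*} [MeasurableSpace Ω] (P : Measure Ω) (n : ℝ) (W : ℝ≥0 → Ω → ℝ)
    (f : TimeInterval → ℝ) : Measure (TimeInterval → ℝ) :=
  P.map (whiteNoisePath n W f)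

/-- The `L²(-1/2, 1/2)` norm. -/
def functionNorm (f : TimeInterval → ℝ) : ℝ≥0∞ := eLpNorm f 2 timeMeasure

/-- The law of the data `Y(i) = f(i) + n^{-1/2} z_i`, `i ∈ M`, of the Gaussian sequence model:
independent normal coordinates with means `f(i)` and variance `1/n`. -/
def sequenceLaw {M : Type*} (n : ℝ) (f : M → ℝ) : Measure (M → ℝ) :=
  Measure.infinitePi fun i => gaussianReal (f i) (Real.toNNReal (1 / n))

/-- The `ℓ²` norm over the index set `M`. -/
def sequenceNorm {M : Type*} (f : M → ℝ) : ℝ≥0∞ :=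
  (∑' i, ENNReal.ofReal (f i ^ 2)) ^ (1 / 2 : ℝ)

/-! ### Confidence intervals and moduli of continuity -/

variable {S : Type*}

/-- A confidence procedure with interval values: a jointly measurable assignment to the data of
an interval (open, closed, unbounded or empty intervals are all allowed). -/
structure IsIntervalProcedure (C : (S → ℝ) → Set ℝ) : Prop where
  ordConnected : ∀ y, (C y).OrdConnected
  measurableSet_graph : MeasurableSet {p : (S → ℝ) × ℝ | p.2 ∈ C p.1}

/-- The class `I_{α,G}` of confidence intervals covering `T f` with probability at least `1 - α`
for every `f ∈ G`. -/
def confidenceIntervals (law : (S → ℝ) → Measure (S → ℝ)) (T : (S → ℝ) →ₗ[ℝ] ℝ) (α : ℝ)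
    (G : Set (S → ℝ)) : Set ((S → ℝ) → Set ℝ) :=
  {C | IsIntervalProcedure C ∧ ∀ f ∈ G, ENNReal.ofReal (1 - α) ≤ law f {y | T f ∈ C y}}

/-- The maximum expected length `L(C, F) = sup_{f ∈ F} E_f (length of C)`. -/
def maxExpectedLength (law : (S → ℝ) → Measure (S → ℝ)) (C : (S → ℝ) → Set ℝ)
    (F : Set (S → ℝ)) : ℝ≥0∞ :=
  ⨆ f ∈ F, ∫⁻ y, volume (C y) ∂(law f)

/-- The benchmark `L*_α(F, G) = inf_{C ∈ I_{α,G}} L(C, F)`. -/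
def optimalExpectedLength (law : (S → ℝ) → Measure (S → ℝ)) (T : (S → ℝ) →ₗ[ℝ] ℝ) (α : ℝ)
    (F G : Set (S → ℝ)) : ℝ≥0∞ :=
  ⨅ C ∈ confidenceIntervals law T α G, maxExpectedLength law C F

/-- The differences `T g - T f` with `f ∈ F`, `g ∈ G` and `‖g - f‖ ≤ ε`. -/
def modulusSet (norm2 : (S → ℝ) → ℝ≥0∞) (T : (S → ℝ) →ₗ[ℝ] ℝ) (ε : ℝ) (F G : Set (S → ℝ)) :
    Set ℝ :=
  {d | ∃ f ∈ F, ∃ g ∈ G, norm2 (g - f) ≤ ENNReal.ofReal ε ∧ d = T g - T f}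

/-- The ordered modulus of continuity
`ω(ε, F, G) = sup {T g - T f : ‖g - f‖ ≤ ε, f ∈ F, g ∈ G}`. -/
def orderedModulus (norm2 : (S → ℝ) → ℝ≥0∞) (T : (S → ℝ) →ₗ[ℝ] ℝ) (ε : ℝ)
    (F G : Set (S → ℝ)) : ℝ :=
  sSup (modulusSet norm2 T ε F G)

/-! ### Linear estimators and the interval -/

/-- `That` is a linear estimator (a constant term is allowed) over `G`: a statistic that, for the
observations under any `f ∈ G`, is a mean-square limit of a constant plus finite linear
combinations of the data. In the white noise model, where `Y(-1/2) = 0`, finite combinations of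
the `Y(t)` are the integrals `∫ c dY` of step functions `c`, and the limits are the integrals
`∫ c dY` of square integrable `c`; in the sequence model they are the series `∑ c_i Y(i)`. -/
structure IsLinearEstimator (law : (S → ℝ) → Measure (S → ℝ)) (G : Set (S → ℝ))
    (That : (S → ℝ) → ℝ) : Prop where
  measurable : Measurable That
  limit : ∃ (a : ℝ) (c : ℕ → S →₀ ℝ), ∀ f ∈ G,
    Tendsto (fun m => eLpNorm (fun y => That y - (a + (c m).sum fun s r => r * y s)) 2 (law f))
      atTop (𝓝 0)

/-- `That` is a linear estimator over `G` whose variance is at most `w² / z_{α/2}²`, whose bias is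
at least `-w/2` over `F₂` and at most `w/2` over `F₁`. -/
structure IsBalancedEstimator (law : (S → ℝ) → Measure (S → ℝ)) (T : (S → ℝ) →ₗ[ℝ] ℝ) (α : ℝ)
    (G : Set (S → ℝ)) (w : ℝ) (F₁ F₂ : Set (S → ℝ)) (That : (S → ℝ) → ℝ) : Prop where
  linear : IsLinearEstimator law G That
  variance_le : ∀ f ∈ G, Var[That; law f] ≤ 1 / normalQuantile (α / 2) ^ 2 * w ^ 2
  bias_ge : ∀ f ∈ F₂, -(1 / 2) * w ≤ (∫ y, That y ∂(law f)) - T f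
  bias_le : ∀ f ∈ F₁, (∫ y, That y ∂(law f)) - T f ≤ 1 / 2 * w

/-- The interval
`CI*_j = [min_i {That_{i,j} - (3/2) w_{i,j}}, max_i {That_{j,i} + (3/2) w_{j,i}}]`. -/
def adaptiveInterval {k : ℕ} (That : Fin k → Fin k → (S → ℝ) → ℝ) (w : Fin k → Fin k → ℝ)
    (j : Fin k) (y : S → ℝ) : Set ℝ :=
  Set.Icc (⨅ i, (That i j y - 3 / 2 * w i j)) (⨆ i, (That j i y + 3 / 2 * w j i))

/-- The constant `(8 √(log (k + 1)) + 4 z_{α/2}) / ((1/2 - α) z_α)`. -/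
def lengthFactor (k : ℕ) (α : ℝ) : ℝ :=
  (8 * √(Real.log (k + 1)) + 4 * normalQuantile (α / 2)) / ((1 / 2 - α) * normalQuantile α)

end

/-! ### The standard normal distribution and its quantiles -/

/-! Both models are Gaussian fields with covariance `⟪e s, e t⟫` in a Hilbert space, and moving the
parameter from `f` to `g` shifts the mean by `s ↦ ⟪u, e s⟫` with `‖u‖` at most `√n` times any finite
bound on the distance of `f` and `g`. The argument is carried out once for this structure,
`IsGaussianModel`.

Coverage: a balanced estimator is Gaussian, being a mean-square limit of Gaussian variables. Its
bias on the relevant side is at most `ω/2`, so the margin `3ω/2` leaves `ω`, which is at least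
`z_{α/2}` standard deviations. Each endpoint therefore errs with probability at most `α/2`.

Length: over `F j` each shifted endpoint has mean distance at most `2ω` from `T f` and standard
deviation at most `ω / z_{α/2}`. The expected maximum of `k` such variables, with no independence,
is controlled by exponential moments (`lintegral_iSup_gaussian_le`).

Benchmark: if `f` and `g` are within `z_α / √n`, Cameron-Martin and Neyman-Pearson
(`half_le_of_shift`) show that an interval covering `T g` with probability `1 - α` under `g`
contains it with probability at least `1/2` under `f`. It then contains both values with probability
at least `1/2 - α`, hence is long. Contracting towards a common point of the two convex sets by `z_α
/ z_{α/2}` reaches this radius, so every relevant modulus is at most a constant times the benchmark.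
The length bound turns this into the theorem. -/

lemma continuous_cdf_of_nullSingletonClass (μ : Measure ℝ) [IsProbabilityMeasure μ] [NullSingletonClass μ] :
    Continuous (cdf μ) := by
  refine continuous_iff_continuousAt.2 fun x => ?_
  refine (cdf μ).mono.continuousAt_iff_leftLim_eq_rightLim.2 ?_
  rw [(cdf μ).rightLim_eq]
  have h : (cdf μ).measure {x} = 0 := by rw [measure_cdf]; simp
  rw [StieltjesFunction.measure_singleton, ENNReal.ofReal_eq_zero] at h
  exact le_antisymm ((cdf μ).mono.leftLim_le le_rfl) (by linarith)

instance nullSingletonClass_stdGaussian : NullSingletonClass (gaussianReal 0 1) :=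
  nullSingletonClass_gaussianReal one_ne_zero

lemma cdf_stdGaussian_neg (x : ℝ) :
    cdf (gaussianReal 0 1) (-x) = 1 - cdf (gaussianReal 0 1) x := by
  rw [cdf_eq_real, cdf_eq_real, ← probReal_compl_eq_one_sub measurableSet_Iic, Set.compl_Iic]
  have h : (gaussianReal 0 1).map (fun x => -x) = gaussianReal 0 1 := by
    rw [gaussianReal_map_neg, neg_zero]
  conv_lhs => rw [← h]
  rw [map_measureReal_apply measurable_neg measurableSet_Iic]
  have : (fun x : ℝ => -x) ⁻¹' Set.Iic (-x) = Set.Ici x := by ext; simp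
  rw [this]
  exact measureReal_congr Ioi_ae_eq_Ici.symm

lemma cdf_stdGaussian_zero : cdf (gaussianReal 0 1) 0 = 1 / 2 := by
  have := cdf_stdGaussian_neg 0
  rw [neg_zero] at this
  linarith

section Quantile

variable {α : ℝ}

lemma bddBelow_setOf_le_cdf (h1 : α < 1) :
    BddBelow {x : ℝ | 1 - α ≤ cdf (gaussianReal 0 1) x} := by
  obtain ⟨b, hb⟩ := ((tendsto_cdf_atBot (gaussianReal 0 1)).eventually
    (gt_mem_nhds (show (0 : ℝ) < 1 - α by linarith))).exists
  refine ⟨b, fun x hx => ?_⟩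
  by_contra! hlt
  exact absurd (hx.out.trans (monotone_cdf _ hlt.le)) (not_le.2 hb)

lemma exists_cdf_eq (h0 : 0 < α) (h1 : α < 1) :
    ∃ x, cdf (gaussianReal 0 1) x = 1 - α := by
  obtain ⟨b, hb⟩ := ((tendsto_cdf_atBot (gaussianReal 0 1)).eventually
    (gt_mem_nhds (show (0 : ℝ) < 1 - α by linarith))).exists
  obtain ⟨c, hc⟩ := ((tendsto_cdf_atTop (gaussianReal 0 1)).eventually
    (lt_mem_nhds (show 1 - α < 1 by linarith))).exists
  exact mem_range_of_exists_le_of_exists_ge (continuous_cdf_of_nullSingletonClass _) ⟨b, hb.le⟩ ⟨c, hc.le⟩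

lemma cdf_normalQuantile (h0 : 0 < α) (h1 : α < 1) :
    cdf (gaussianReal 0 1) (normalQuantile α) = 1 - α := by
  obtain ⟨x, hx⟩ := exists_cdf_eq h0 h1
  have hcl : IsClosed {x : ℝ | 1 - α ≤ cdf (gaussianReal 0 1) x} :=
    isClosed_le continuous_const (continuous_cdf_of_nullSingletonClass _)
  refine le_antisymm ?_ (hcl.csInf_mem ⟨x, hx.ge⟩ (bddBelow_setOf_le_cdf h1))
  rw [← hx]
  exact monotone_cdf _ (csInf_le (bddBelow_setOf_le_cdf h1) hx.ge)

lemma normalQuantile_pos (h0 : 0 < α) (h1 : α < 1 / 2) : 0 < normalQuantile α := by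
  by_contra! h
  have := monotone_cdf (gaussianReal 0 1) h
  rw [cdf_normalQuantile h0 (by linarith), cdf_stdGaussian_zero] at this
  linarith

lemma normalQuantile_le_half (h0 : 0 < α) (h1 : α < 1) :
    normalQuantile α ≤ normalQuantile (α / 2) := by
  obtain ⟨x, hx⟩ := exists_cdf_eq (half_pos h0) (by linarith)
  refine csInf_le_csInf (bddBelow_setOf_le_cdf h1) ⟨x, hx.ge⟩ fun y hy => ?_
  have := hy.out
  exact le_trans (by linarith) this

lemma gaussianReal_eq_map_std (a : ℝ) (v : ℝ≥0) :
    gaussianReal a v = (gaussianReal 0 1).map (fun x => √(v : ℝ) * x + a) := by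
  have : (fun x => √(v : ℝ) * x + a) = (fun x => x + a) ∘ (fun x => √(v : ℝ) * x) := rfl
  rw [this, ← Measure.map_map (by fun_prop) (by fun_prop), gaussianReal_map_const_mul,
    gaussianReal_map_add_const]
  congr 1
  · simp
  · ext; simp

/-- After standardising, `b` lies at least `z_α` standard deviations below the mean. The half-line
is open so that the degenerate case `v = 0`, `a = b` is included. -/
lemma gaussianReal_Iio_le (h0 : 0 < α) (h1 : α < 1) {a b : ℝ} {v : ℝ≥0}
    (h : √(v : ℝ) * normalQuantile α ≤ a - b) :
    gaussianReal a v (Set.Iio b) ≤ ENNReal.ofReal α := by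
  rw [gaussianReal_eq_map_std, Measure.map_apply (by fun_prop) measurableSet_Iio]
  have hsub : (fun x => √(v : ℝ) * x + a) ⁻¹' Set.Iio b ⊆ Set.Iic (-normalQuantile α) := by
    intro x hx
    simp only [Set.mem_preimage, Set.mem_Iio] at hx
    by_contra! hlt
    simp only [Set.mem_Iic, not_le] at hlt
    nlinarith [Real.sqrt_nonneg (v : ℝ)]
  refine (measure_mono hsub).trans ?_
  rw [← ofReal_cdf, cdf_stdGaussian_neg, cdf_normalQuantile h0 h1]
  simp

lemma measure_lt_le_of_gaussian {Ω : Type*} [MeasurableSpace Ω] {μ : Measure Ω} {X : Ω → ℝ}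
    (hXm : Measurable X) (h0 : 0 < α) (h1 : α < 1) {a b : ℝ} {v : ℝ≥0}
    (hX : μ.map X = gaussianReal a v) (h : √(v : ℝ) * normalQuantile α ≤ a - b) :
    μ {ω | X ω < b} ≤ ENNReal.ofReal α := by
  have := gaussianReal_Iio_le h0 h1 h
  rwa [← hX, Measure.map_apply hXm measurableSet_Iio] at this

end Quantile

/-! ### Square-integrable limits of Gaussian variables -/

section Limits

variable {Ω : Type*} [MeasurableSpace Ω] {μ : Measure Ω}

lemma Lp.integral_eq_inner_one [IsFiniteMeasure μ] (X : Lp ℝ 2 μ) :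
    ∫ ω, X ω ∂μ = inner ℝ (indicatorConstLp 2 MeasurableSet.univ (measure_ne_top μ _) (1 : ℝ)) X := by
  rw [L2.inner_indicatorConstLp_one, setIntegral_univ]

lemma Lp.integral_sq_eq_norm_sq (X : Lp ℝ 2 μ) : ∫ ω, X ω ^ 2 ∂μ = ‖X‖ ^ 2 := by
  rw [← real_inner_self_eq_norm_sq, L2.inner_def]
  refine integral_congr_ae (.of_forall fun ω => ?_)
  simp [pow_two]

lemma Lp.continuous_integral [IsFiniteMeasure μ] :
    Continuous fun X : Lp ℝ 2 μ => ∫ ω, X ω ∂μ := by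
  simp_rw [Lp.integral_eq_inner_one]
  fun_prop

lemma Lp.variance_eq_norm_sq_sub [IsProbabilityMeasure μ] (X : Lp ℝ 2 μ) :
    Var[X; μ] = ‖X‖ ^ 2 - (∫ ω, X ω ∂μ) ^ 2 := by
  rw [variance_eq_sub (Lp.memLp X), ← Lp.integral_sq_eq_norm_sq]
  rfl

/-- Convergence in `L²` gives convergence in distribution and also of means and variances. Gaussian
characteristic functions depend continuously on these two numbers, so the limiting characteristic
function is again Gaussian, possibly degenerate. -/
lemma ProbabilityTheory.HasGaussianLaw.of_tendsto_Lp [IsProbabilityMeasure μ] {X : ℕ → Lp ℝ 2 μ}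
    {Y : Lp ℝ 2 μ} (hX : ∀ m, HasGaussianLaw (X m) μ) (h : Tendsto X atTop (𝓝 Y)) :
    HasGaussianLaw Y μ := by
  have hd : TendstoInDistribution (fun m => (X m : Ω → ℝ)) atTop Y (fun _ => μ) μ :=
    (tendstoInMeasure_of_tendsto_Lp h).tendstoInDistribution
      fun m => (Lp.aestronglyMeasurable (X m)).aemeasurable
  have hY : AEMeasurable Y μ := (Lp.aestronglyMeasurable Y).aemeasurable
  have hmean := (Lp.continuous_integral.tendsto Y).comp h
  have hvar : Tendsto (fun m => Var[X m; μ]) atTop (𝓝 Var[Y; μ]) := by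
    simp_rw [Lp.variance_eq_norm_sq_sub]
    exact (h.norm.pow 2).sub (hmean.pow 2)
  have hlaw : μ.map Y = gaussianReal (∫ ω, Y ω ∂μ) Var[Y; μ].toNNReal := by
    have := Measure.isProbabilityMeasure_map (μ := μ) hY
    refine Measure.ext_of_charFun (funext fun t => ?_)
    refine tendsto_nhds_unique
      ((ProbabilityMeasure.tendsto_iff_tendsto_charFun.1 hd.tendsto) t) ?_
    rw [charFun_gaussianReal]
    simp only [ProbabilityMeasure.coe_mk]
    simp_rw [(hX _).map_eq_gaussianReal, charFun_gaussianReal]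
    refine (Complex.continuous_exp.tendsto _).comp (Tendsto.sub ?_ ?_)
    · refine (Tendsto.const_mul _ ?_).mul_const _
      exact (Complex.continuous_ofReal.tendsto _).comp hmean
    · refine (Tendsto.mul_const _ ?_).div_const _
      simp only [Real.coe_toNNReal _ (variance_nonneg _ _)]
      exact (Complex.continuous_ofReal.tendsto _).comp hvar
  exact ⟨hlaw ▸ inferInstance⟩

lemma ProbabilityTheory.HasGaussianLaw.of_tendsto_eLpNorm [IsProbabilityMeasure μ]
    {X : ℕ → Ω → ℝ} {Y : Ω → ℝ} (hY : AEStronglyMeasurable Y μ) (hX : ∀ m, HasGaussianLaw (X m) μ)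
    (h : Tendsto (fun m => eLpNorm (fun ω => Y ω - X m ω) 2 μ) atTop (𝓝 0)) :
    HasGaussianLaw Y μ := by
  obtain ⟨m, hm⟩ := (h.eventually (gt_mem_nhds one_pos)).exists
  have hY2 : MemLp Y 2 μ := by
    have : MemLp (fun ω => Y ω - X m ω) 2 μ :=
      ⟨hY.sub (hX m).memLp_two.1, hm.trans ENNReal.one_lt_top⟩
    refine (this.add (hX m).memLp_two).congr_norm hY (.of_forall fun ω => ?_)
    simp
  have hlim := (Lp.tendsto_Lp_iff_tendsto_eLpNorm'' X (fun m => (hX m).memLp_two) Y hY2).2 (by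
    refine h.congr fun m => ?_
    rw [← eLpNorm_neg]
    congr 1
    ext ω
    simp)
  refine (HasGaussianLaw.of_tendsto_Lp (fun m => ?_) hlim).congr hY2.coeFn_toLp
  exact (hX m).congr (hX m).memLp_two.coeFn_toLp.symm

end Limits

/-! ### The expected maximum of Gaussian variables -/

section Maximum

variable {Ω ι : Type*} [MeasurableSpace Ω] {μ : Measure Ω} [Fintype ι] [Nonempty ι]

/-- Exponential moments bound the maximum without independence. The extra `1` in `card ι + 1` is the
term `exp 0`, which accounts for the positive part. A tangent line to the logarithm replaces
Jensen's inequality and gives an explicit integrable majorant. -/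
lemma lintegral_iSup_gaussian_le_of_pos [IsProbabilityMeasure μ] {X : ι → Ω → ℝ} {m : ι → ℝ}
    {v : ι → ℝ≥0} (hX : ∀ i, μ.map (X i) = gaussianReal (m i) (v i)) {a s r : ℝ} (ha : 0 ≤ a)
    (hm : ∀ i, m i ≤ a) (hv : ∀ i, (v i : ℝ) ≤ s) (hr : 0 < r) :
    ∫⁻ ω, ENNReal.ofReal (⨆ i, X i ω) ∂μ
      ≤ ENNReal.ofReal (a + (Real.log (Fintype.card ι + 1) / r + r * s / 2)) := by
  have hs : 0 ≤ s := (v (Classical.arbitrary ι)).2.trans (hv _)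
  set K : ℝ := (Fintype.card ι : ℝ) with hK
  have hK0 : 0 ≤ K := Nat.cast_nonneg _
  have hXm : ∀ i, AEMeasurable (X i) μ := fun i =>
    aemeasurable_of_map_neZero (by rw [hX]; infer_instance)
  -- `exp c = (K + 1) exp (r² s / 2)` bounds the expectation of `1 + ∑ exp (r (X i - a))`; the
  -- logarithm is linearised at this point.
  set c : ℝ := Real.log (K + 1) + r ^ 2 * s / 2 with hc
  have hint : ∀ i, Integrable (fun ω => Real.exp (r * X i ω)) μ := fun i => by
    have := (integrable_exp_mul_gaussianReal (μ := m i) (v := v i) r)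
    rw [← hX i] at this
    exact this.comp_aemeasurable (hXm i)
  have hmgf : ∀ i, ∫ ω, Real.exp (r * X i ω) ∂μ ≤ Real.exp (r * a) * Real.exp (r ^ 2 * s / 2) := by
    intro i
    have := mgf_gaussianReal (hX i) r
    rw [mgf] at this
    rw [this, ← Real.exp_add]
    refine Real.exp_le_exp.2 ?_
    have h1 := mul_le_mul_of_nonneg_right (hm i) hr.le
    have h2 := mul_le_mul_of_nonneg_right (hv i) (sq_nonneg r)
    linarith
  -- This is `a + log y / r` for `y = 1 + ∑ exp (r (X i - a))`, with `log y` replaced by its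
  -- majorant `c - 1 + exp (-c) * y`.
  set g : Ω → ℝ := fun ω =>
    a + (c - 1 + Real.exp (-c) * (1 + Real.exp (-(r * a)) * ∑ i, Real.exp (r * X i ω))) / r with hg
  have hgint : Integrable g μ := by
    refine (integrable_const _).add (Integrable.div_const ?_ _)
    refine (integrable_const _).add (Integrable.const_mul ?_ _)
    exact (integrable_const _).add ((integrable_finsetSum _ fun i _ => hint i).const_mul _)
  have hle : ∀ ω, (⨆ i, X i ω) ≤ g ω := by
    intro ω
    obtain ⟨i, hi⟩ := exists_eq_ciSup_of_finite (f := fun i => X i ω)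
    rw [← hi]
    have h1 := Real.add_one_le_exp (r * (X i ω - a) - c)
    have h2 : Real.exp (r * (X i ω - a) - c)
        = Real.exp (-c) * (Real.exp (-(r * a)) * Real.exp (r * X i ω)) := by
      rw [← Real.exp_add, ← Real.exp_add]
      congr 1
      ring
    have h3 : Real.exp (r * X i ω) ≤ ∑ i, Real.exp (r * X i ω) :=
      Finset.single_le_sum (f := fun i => Real.exp (r * X i ω)) (fun i _ => (Real.exp_pos _).le)
        (Finset.mem_univ i)
    have h4 : Real.exp (-c) * (Real.exp (-(r * a)) * Real.exp (r * X i ω)) ≤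
        Real.exp (-c) * (1 + Real.exp (-(r * a)) * ∑ i, Real.exp (r * X i ω)) := by
      gcongr
      have := mul_le_mul_of_nonneg_left h3 (Real.exp_pos (-(r * a))).le
      linarith
    have h5 : X i ω - a ≤ (c - 1 +
        Real.exp (-c) * (1 + Real.exp (-(r * a)) * ∑ i, Real.exp (r * X i ω))) / r := by
      rw [le_div_iff₀ hr]
      linarith
    simp only [hg]
    linarith
  have hg0 : ∀ ω, 0 ≤ g ω := by
    intro ω
    have h1 := Real.add_one_le_exp (-c)
    have h3 : 0 ≤ Real.exp (-(r * a)) * ∑ i, Real.exp (r * X i ω) :=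
      mul_nonneg (Real.exp_pos _).le (Finset.sum_nonneg fun i _ => (Real.exp_pos _).le)
    have h4 := mul_nonneg (Real.exp_pos (-c)).le h3
    refine add_nonneg ha (div_nonneg ?_ hr.le)
    linarith
  have hgval : ∫ ω, g ω ∂μ ≤ a + (Real.log (K + 1) / r + r * s / 2) := by
    have h1 : ∫ ω, g ω ∂μ = a + (c - 1 + Real.exp (-c) * (1 + Real.exp (-(r * a)) *
        ∑ i, ∫ ω, Real.exp (r * X i ω) ∂μ)) / r := by
      have hi1 : Integrable (fun ω => ∑ i, Real.exp (r * X i ω)) μ :=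
        integrable_finsetSum _ fun i _ => hint i
      have hi2 : Integrable (fun ω => 1 + Real.exp (-(r * a)) * ∑ i, Real.exp (r * X i ω)) μ :=
        (integrable_const _).add (hi1.const_mul _)
      have hi3 : Integrable (fun ω => c - 1 + Real.exp (-c) *
          (1 + Real.exp (-(r * a)) * ∑ i, Real.exp (r * X i ω))) μ :=
        (integrable_const _).add (hi2.const_mul _)
      simp only [hg]
      rw [integral_add (integrable_const _) (hi3.div_const _), integral_div,
        integral_add (integrable_const _) (hi2.const_mul _), integral_const_mul,
        integral_add (integrable_const _) (hi1.const_mul _), integral_const_mul,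
        integral_finsetSum _ fun i _ => hint i]
      simp
    have h2 : ∑ i, ∫ ω, Real.exp (r * X i ω) ∂μ
        ≤ K * (Real.exp (r * a) * Real.exp (r ^ 2 * s / 2)) := by
      refine (Finset.sum_le_sum fun i _ => hmgf i).trans ?_
      simp [hK]
    have h3 : Real.exp (-(r * a)) * ∑ i, ∫ ω, Real.exp (r * X i ω) ∂μ
        ≤ K * Real.exp (r ^ 2 * s / 2) := by
      refine (mul_le_mul_of_nonneg_left h2 (Real.exp_pos _).le).trans_eq ?_
      have : Real.exp (-(r * a)) * Real.exp (r * a) = 1 := by rw [← Real.exp_add]; simp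
      linear_combination K * Real.exp (r ^ 2 * s / 2) * this
    have h4 : 1 ≤ Real.exp (r ^ 2 * s / 2) := Real.one_le_exp (by positivity)
    have h5 : Real.exp (-c) * (1 + Real.exp (-(r * a)) * ∑ i, ∫ ω, Real.exp (r * X i ω) ∂μ) ≤ 1 := by
      have hec : Real.exp c = (K + 1) * Real.exp (r ^ 2 * s / 2) := by
        rw [hc, Real.exp_add, Real.exp_log (by linarith)]
      rw [Real.exp_neg, inv_mul_le_iff₀ (Real.exp_pos _), hec]
      linarith
    rw [h1]
    have h6 : (c - 1 + Real.exp (-c) * (1 + Real.exp (-(r * a)) *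
        ∑ i, ∫ ω, Real.exp (r * X i ω) ∂μ)) / r ≤ c / r :=
      div_le_div_of_nonneg_right (by linarith) hr.le
    have h7 : c / r = Real.log (K + 1) / r + r * s / 2 := by
      rw [hc]
      field_simp
    linarith
  calc ∫⁻ ω, ENNReal.ofReal (⨆ i, X i ω) ∂μ ≤ ∫⁻ ω, ENNReal.ofReal (g ω) ∂μ :=
        lintegral_mono fun ω => ENNReal.ofReal_le_ofReal (hle ω)
    _ = ENNReal.ofReal (∫ ω, g ω ∂μ) :=
        (ofReal_integral_eq_lintegral_ofReal hgint (.of_forall hg0)).symm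
    _ ≤ _ := ENNReal.ofReal_le_ofReal hgval

lemma lintegral_iSup_gaussian_le [IsProbabilityMeasure μ] {X : ι → Ω → ℝ} {m : ι → ℝ}
    {v : ι → ℝ≥0} (hX : ∀ i, μ.map (X i) = gaussianReal (m i) (v i)) {a σ : ℝ} (ha : 0 ≤ a)
    (hσ : 0 ≤ σ) (hm : ∀ i, m i ≤ a) (hv : ∀ i, (v i : ℝ) ≤ σ ^ 2) :
    ∫⁻ ω, ENNReal.ofReal (⨆ i, X i ω) ∂μ
      ≤ ENNReal.ofReal (a + σ * √(2 * Real.log (Fintype.card ι + 1))) := by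
  set l := Real.log (Fintype.card ι + 1) with hl
  have hl0 : 0 < l := Real.log_pos (by
    have : (0 : ℝ) < Fintype.card ι := by exact_mod_cast Fintype.card_pos
    linarith)
  have key := fun r hr => lintegral_iSup_gaussian_le_of_pos (r := r) hX ha hm hv hr
  rcases hσ.eq_or_lt with rfl | hσ
  -- With `σ = 0` no finite `r` is optimal, so `r → ∞`.
  · have hlim : Tendsto (fun r : ℝ => ENNReal.ofReal (a + (l / r + r * 0 ^ 2 / 2))) atTop
        (𝓝 (ENNReal.ofReal (a + 0 * √(2 * l)))) := by
      refine ENNReal.tendsto_ofReal ?_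
      simpa using (tendsto_const_nhds (x := l)).div_atTop tendsto_id |>.const_add a
    exact ge_of_tendsto hlim ((eventually_gt_atTop 0).mono key)
  · have hs : 0 < √(2 * l) := Real.sqrt_pos.2 (by linarith)
    have hsq : √(2 * l) ^ 2 = 2 * l := Real.sq_sqrt (by linarith)
    -- This `r` minimises `l / r + r σ² / 2`.
    refine (key (√(2 * l) / σ) (div_pos hs hσ)).trans_eq ?_
    congr 2
    have h1 : l = √(2 * l) ^ 2 / 2 := by linarith
    rw [← hl]
    generalize √(2 * l) = q at *
    rw [h1]
    field_simp
    ring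

end Maximum

/-! ### Identification of Gaussian laws -/

section Identification

variable {Ω : Type*} [MeasurableSpace Ω] {μ : Measure Ω}

/-- A moment generating function finite on the whole line extends analytically to the complex plane
and so determines the law. -/
lemma map_eq_gaussianReal_of_mgf [IsProbabilityMeasure μ] {X : Ω → ℝ} (hX : AEMeasurable X μ)
    {a : ℝ} {v : ℝ≥0} (h : ∀ t, mgf X μ t = Real.exp (a * t + v * t ^ 2 / 2)) :
    μ.map X = gaussianReal a v := by
  have hm : mgf X μ = mgf id (gaussianReal a v) := by
    rw [mgf_id_gaussianReal]
    exact funext h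
  have hset : integrableExpSet X μ = Set.univ := by
    rw [integrableExpSet_eq_of_mgf hm, integrableExpSet_id_gaussianReal]
  have := Measure.ext_of_complexMGF_eq (μ' := gaussianReal a v) hX aemeasurable_id
    (funext fun z => eqOn_complexMGF_of_mgf hm (by simp [hset]))
  simpa using this

/-- The Bochner integral of a non-integrable function is `0`, so a positive value certifies
integrability. -/
lemma integrable_exp_of_integral_ne_zero {f : Ω → ℝ} {r : ℝ}
    (h : ∫ ω, Real.exp (f ω) ∂μ = Real.exp r) : Integrable (fun ω => Real.exp (f ω)) μ := by
  by_contra hn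
  rw [integral_undef hn] at h
  exact (Real.exp_pos r).ne h

/-- The hypothesis gives exponential moments of a Gaussian pair: `X` with mean `a` and variance `v`,
a centered `ξ` with variance `d`, and covariance `b`. Dividing by the normaliser `exp (d / 2)` shows
that the tilt moves the mean of `X` by the covariance. -/
lemma map_tilted_eq_gaussianReal [IsProbabilityMeasure μ] {X ξ : Ω → ℝ} (hX : Measurable X)
    {a b d : ℝ} {v : ℝ≥0}
    (h : ∀ t : ℝ, ∫ ω, Real.exp (t * X ω + ξ ω) ∂μ
      = Real.exp (t * a + (d + 2 * t * b + t ^ 2 * v) / 2)) :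
    (μ.tilted ξ).map X = gaussianReal (a + b) v := by
  have h0 : ∫ ω, Real.exp (ξ ω) ∂μ = Real.exp (d / 2) := by simpa using h 0
  have := isProbabilityMeasure_tilted (integrable_exp_of_integral_ne_zero h0)
  refine map_eq_gaussianReal_of_mgf hX.aemeasurable fun t => ?_
  rw [mgf, integral_exp_tilted, h0]
  have : ∀ ω, (ξ + fun ω => t * X ω) ω = t * X ω + ξ ω := fun ω => by simp [add_comm]
  simp_rw [this, h t]
  rw [← Real.exp_sub]
  congr 1
  ring

end Identification

section Field

variable {S : Type*}

@[fun_prop]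
lemma measurable_linearCombination (c : S →₀ ℝ) :
    Measurable fun y : S → ℝ => Finsupp.linearCombination ℝ y c := by
  simp only [Finsupp.linearCombination_apply, Finsupp.sum]
  fun_prop

/-- Cramér-Wold on each finite-dimensional marginal, then uniqueness of the projective limit. -/
lemma ext_of_map_linearCombination {μ ν : Measure (S → ℝ)} [IsFiniteMeasure μ] [IsFiniteMeasure ν]
    (h : ∀ c : S →₀ ℝ, μ.map (fun y => Finsupp.linearCombination ℝ y c)
      = ν.map fun y => Finsupp.linearCombination ℝ y c) : μ = ν := by
  refine IsProjectiveLimit.unique (P := fun I : Finset S => ν.map I.restrict) (fun I => ?_)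
    fun I => rfl
  refine Measure.ext_of_charFunDual (funext fun L => ?_)
  rw [charFunDual_eq_charFun_map_one, charFunDual_eq_charFun_map_one,
    Measure.map_map (by fun_prop) (by fun_prop), Measure.map_map (by fun_prop) (by fun_prop)]
  classical
  have hL : ⇑L ∘ I.restrict = fun y : S → ℝ => Finsupp.linearCombination ℝ y
      (∑ i : I, Finsupp.single (i : S) (L (Pi.single i 1))) := by
    ext y
    have hy : I.restrict y = ∑ i : I, y i • (Pi.single i (1 : ℝ) : I → ℝ) := by
      ext i
      simp [Finset.sum_apply, Pi.single_apply]
    simp only [Function.comp_apply]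
    rw [hy, map_sum, map_sum]
    refine Finset.sum_congr rfl fun i _ => ?_
    simp [mul_comm]
  rw [hL, h]

end Field

/-! ### Testing two shifted Gaussian laws -/

section Testing

variable {Ω : Type*} [MeasurableSpace Ω] {μ : Measure Ω}

lemma integral_exp_mul_gaussian {ξ : Ω → ℝ} {v : ℝ≥0} (hlaw : μ.map ξ = gaussianReal 0 v)
    (t : ℝ) : ∫ ω, Real.exp (t * ξ ω) ∂μ = Real.exp (v * t ^ 2 / 2) := by
  have := mgf_gaussianReal hlaw t
  rw [mgf] at this
  rw [this]
  simp

/-- The Neyman-Pearson bound for a Gaussian log-likelihood ratio: if the event `A` has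
probability at least `1 - α` after an exponential tilt of standard deviation at most `z_α`, then
its original probability is at least `1 / 2`. -/
lemma half_le_of_tilted_gaussian [IsProbabilityMeasure μ] {ξ : Ω → ℝ} (hξ : Measurable ξ)
    {v : ℝ≥0} (hlaw : μ.map ξ = gaussianReal 0 v) {α : ℝ} (h0 : 0 < α) (h1 : α < 1 / 2)
    (hv : √(v : ℝ) ≤ normalQuantile α) {A : Set Ω} (hA : MeasurableSet A)
    (hcov : 1 - α ≤ (μ.tilted ξ).real A) : 1 / 2 ≤ μ.real A := by
  have hexp0 : ∫ ω, Real.exp (ξ ω) ∂μ = Real.exp (v / 2) := by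
    simpa using integral_exp_mul_gaussian hlaw 1
  have hint : Integrable (fun ω => Real.exp (ξ ω)) μ := integrable_exp_of_integral_ne_zero hexp0
  have hprob : IsProbabilityMeasure (μ.tilted ξ) := isProbabilityMeasure_tilted hint
  rcases eq_or_ne v 0 with rfl | hv0
  · have hz : ξ =ᵐ[μ] fun _ => 0 := by
      rw [gaussianReal_zero_var] at hlaw
      exact HasLaw.ae_eq_of_dirac ⟨hξ.aemeasurable, hlaw⟩
    rw [tilted_congr hz, tilted_const] at hcov
    linarith
  have hd : 0 < √(v : ℝ) := Real.sqrt_pos.2 (NNReal.coe_pos.2 (pos_of_ne_zero hv0))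
  have hd2 : √(v : ℝ) * √(v : ℝ) = v := Real.mul_self_sqrt v.2
  -- The Neyman-Pearson region: the likelihood ratio is increasing in `ξ`, and the cut at the median
  -- of `ξ` gives `B` probability exactly `1/2` under `μ`.
  set B : Set Ω := {ω | ξ ω ≤ 0} with hB
  have hBm : MeasurableSet B := measurableSet_le hξ measurable_const
  have hBeq : B = ξ ⁻¹' Set.Iic 0 := rfl
  have hμB : μ.real B = 1 / 2 := by
    rw [hBeq, ← map_measureReal_apply hξ measurableSet_Iic, hlaw, gaussianReal_eq_map_std,
      map_measureReal_apply (by fun_prop) measurableSet_Iic, ← cdf_stdGaussian_zero, cdf_eq_real]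
    congr 1
    ext x
    simp only [Set.mem_preimage, Set.mem_Iic, add_zero]
    exact ⟨fun h => by by_contra! hx; nlinarith, fun h => by nlinarith⟩
  -- Under the tilt `ξ` has mean `v` and variance `v`, so `B` has probability `Φ(-√v) ≥ Φ(-z_α) =
  -- α`.
  have hνB : α ≤ (μ.tilted ξ).real B := by
    have hmap : (μ.tilted ξ).map ξ = gaussianReal (0 + v) v := by
      refine map_tilted_eq_gaussianReal (d := v) hξ fun t => ?_
      have := integral_exp_mul_gaussian hlaw (t + 1)
      simp only [add_mul, one_mul] at this
      rw [this]
      congr 1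
      ring
    rw [hBeq, ← map_measureReal_apply hξ measurableSet_Iic, hmap, gaussianReal_eq_map_std,
      map_measureReal_apply (by fun_prop) measurableSet_Iic]
    have hα : α = (gaussianReal 0 1).real (Set.Iic (-normalQuantile α)) := by
      rw [← cdf_eq_real, cdf_stdGaussian_neg, cdf_normalQuantile h0 (by linarith)]
      ring
    rw [hα]
    refine measureReal_mono fun x hx => ?_
    simp only [Set.mem_preimage, Set.mem_Iic] at hx ⊢
    nlinarith
  -- The value of the tilted density at the cut `ξ = 0`.
  set κ : ℝ := Real.exp (-(v / 2)) with hκ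
  have hκ0 : 0 < κ := Real.exp_pos _
  have hdens : ∀ D : Set Ω, MeasurableSet D →
      (μ.tilted ξ).real D = ∫ ω in D, κ * Real.exp (ξ ω) ∂μ := by
    intro D hD
    rw [measureReal_def, tilted_apply_eq_ofReal_integral' _ hD, hexp0, ENNReal.toReal_ofReal
      (integral_nonneg fun ω => by positivity)]
    refine integral_congr_ae (.of_forall fun ω => ?_)
    simp only [hκ, Real.exp_neg]
    ring
  have hcalc : ∀ D : Set Ω, MeasurableSet D →
      ∫ ω, D.indicator (fun ω => κ * Real.exp (ξ ω) - κ) ω ∂μ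
        = (μ.tilted ξ).real D - κ * μ.real D := by
    intro D hD
    rw [integral_indicator hD, integral_sub (hint.const_mul κ).integrableOn
      (integrable_const κ).integrableOn, ← hdens D hD]
    simp [mul_comm]
  have hintg : Integrable (fun ω => κ * Real.exp (ξ ω) - κ) μ :=
    (hint.const_mul κ).sub (integrable_const κ)
  -- The integrand is nonpositive on `B` and positive off it, so `B` minimises its integral over all
  -- events. Since `Aᶜ` has tilted probability at most `α`, hence at most that of `B`, its
  -- `μ`-probability cannot exceed `1/2`.
  have hmono : ∫ ω, B.indicator (fun ω => κ * Real.exp (ξ ω) - κ) ω ∂μ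
      ≤ ∫ ω, Aᶜ.indicator (fun ω => κ * Real.exp (ξ ω) - κ) ω ∂μ := by
    refine integral_mono (hintg.indicator hBm) (hintg.indicator hA.compl) fun ω => ?_
    by_cases hωB : ω ∈ B
    · have : κ * Real.exp (ξ ω) ≤ κ * 1 :=
        mul_le_mul_of_nonneg_left (Real.exp_le_one_iff.2 hωB) hκ0.le
      by_cases hωA : ω ∈ Aᶜ
      · simp [Set.indicator_of_mem hωB, Set.indicator_of_mem hωA]
      · rw [Set.indicator_of_mem hωB, Set.indicator_of_notMem hωA]
        linarith
    · have hpos : 0 < ξ ω := not_le.1 hωB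
      have : κ * 1 ≤ κ * Real.exp (ξ ω) :=
        mul_le_mul_of_nonneg_left (Real.one_le_exp hpos.le) hκ0.le
      rw [Set.indicator_of_notMem hωB]
      by_cases hωA : ω ∈ Aᶜ
      · rw [Set.indicator_of_mem hωA]
        linarith
      · rw [Set.indicator_of_notMem hωA]
  rw [hcalc B hBm, hcalc _ hA.compl, hμB, probReal_compl_eq_one_sub hA,
    probReal_compl_eq_one_sub hA] at hmono
  by_contra! hlt
  nlinarith

end Testing

/-! ### Gaussian fields and the Cameron-Martin shift -/

section CameronMartin

variable {S H : Type*} [NormedAddCommGroup H] [InnerProductSpace ℝ H]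

/-- `μ` is the law of a Gaussian field on `S` with mean function `m` and covariance function
`⟪e s, e t⟫`. -/
def HasGaussianFieldLaw (e : S → H) (m : S → ℝ) (μ : Measure (S → ℝ)) : Prop :=
  ∀ c : S →₀ ℝ, μ.map (fun y => Finsupp.linearCombination ℝ y c)
    = gaussianReal (Finsupp.linearCombination ℝ m c) (‖Finsupp.linearCombination ℝ e c‖₊ ^ 2)

namespace HasGaussianFieldLaw

variable {e : S → H} {m m' : S → ℝ} {μ ν : Measure (S → ℝ)}

lemma isProbabilityMeasure (h : HasGaussianFieldLaw e m μ) : IsProbabilityMeasure μ := by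
  have : IsProbabilityMeasure (μ.map fun y => Finsupp.linearCombination ℝ y (0 : S →₀ ℝ)) := by
    rw [h]
    infer_instance
  exact μ.isProbabilityMeasure_of_map
    fun y => Finsupp.linearCombination ℝ y (0 : S →₀ ℝ)

/-- The centered linear combination of the data. -/
noncomputable def centered (m : S → ℝ) (c : S →₀ ℝ) (y : S → ℝ) : ℝ :=
  Finsupp.linearCombination ℝ y c - Finsupp.linearCombination ℝ m c

lemma measurable_centered (c : S →₀ ℝ) : Measurable (centered m c) := by
  unfold centered
  fun_prop

lemma map_centered (h : HasGaussianFieldLaw e m μ) (c : S →₀ ℝ) :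
    μ.map (centered m c) = gaussianReal 0 (‖Finsupp.linearCombination ℝ e c‖₊ ^ 2) := by
  have : centered m c = (fun x => x - Finsupp.linearCombination ℝ m c) ∘
    fun y => Finsupp.linearCombination ℝ y c := rfl
  rw [this, ← Measure.map_map (by fun_prop) (by fun_prop), h, gaussianReal_map_sub_const, sub_self]

lemma hasGaussianLaw_centered (h : HasGaussianFieldLaw e m μ) (c : S →₀ ℝ) :
    HasGaussianLaw (centered m c) μ :=
  ⟨by rw [h.map_centered]; infer_instance⟩

/-- The isometric embedding of linear combinations, centered, into `L²` of the law. -/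
noncomputable def embed (h : HasGaussianFieldLaw e m μ) : (S →₀ ℝ) →ₗ[ℝ] Lp ℝ 2 μ where
  toFun c := (h.hasGaussianLaw_centered c).memLp_two.toLp (centered m c)
  map_add' c d := by
    rw [← MemLp.toLp_add]
    congr 1
    ext y
    simp only [centered, map_add, Pi.add_apply]
    ring
  map_smul' r c := by
    rw [RingHom.id_apply, ← MemLp.toLp_const_smul]
    congr 1
    ext y
    simp only [centered, map_smul, Pi.smul_apply, smul_eq_mul]
    ring

lemma coeFn_embed (h : HasGaussianFieldLaw e m μ) (c : S →₀ ℝ) :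
    h.embed c =ᵐ[μ] centered m c :=
  (h.hasGaussianLaw_centered c).memLp_two.coeFn_toLp

lemma integral_embed (h : HasGaussianFieldLaw e m μ) (c : S →₀ ℝ) :
    ∫ y, h.embed c y ∂μ = 0 := by
  rw [integral_congr_ae (h.coeFn_embed c)]
  have := integral_map (μ := μ) (measurable_centered (m := m) c).aemeasurable
    (f := id) (by fun_prop)
  rw [h.map_centered] at this
  simpa using this.symm

lemma hasGaussianLaw_embed (h : HasGaussianFieldLaw e m μ) (c : S →₀ ℝ) :
    HasGaussianLaw (h.embed c) μ :=
  (h.hasGaussianLaw_centered c).congr (h.coeFn_embed c).symm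

lemma norm_embed (h : HasGaussianFieldLaw e m μ) (c : S →₀ ℝ) :
    ‖h.embed c‖ = ‖Finsupp.linearCombination ℝ e c‖ := by
  have := h.isProbabilityMeasure
  have hv := Lp.variance_eq_norm_sq_sub (h.embed c)
  rw [h.integral_embed, variance_congr (h.coeFn_embed c), ← variance_id_map
    (measurable_centered c).aemeasurable, h.map_centered, variance_id_gaussianReal] at hv
  have hv' : ‖h.embed c‖ ^ 2 = ‖Finsupp.linearCombination ℝ e c‖ ^ 2 := by
    simp only [NNReal.coe_pow, coe_nnnorm] at hv
    linarith
  exact (pow_left_inj₀ (norm_nonneg _) (norm_nonneg _) two_ne_zero).1 hv'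

lemma integral_exp_eq_of_gaussian [IsProbabilityMeasure μ] {Z : Lp ℝ 2 μ}
    (hZ : HasGaussianLaw Z μ) (hZ0 : ∫ y, Z y ∂μ = 0) :
    ∫ y, Real.exp (Z y) ∂μ = Real.exp (‖Z‖ ^ 2 / 2) := by
  have h := hZ.map_eq_gaussianReal
  rw [hZ0] at h
  have := integral_exp_mul_gaussian h 1
  rw [Real.coe_toNNReal _ (variance_nonneg _ _), Lp.variance_eq_norm_sq_sub, hZ0] at this
  simpa using this

/-- **Cameron-Martin**: a shift of the mean by a bounded functional of the covariance structure is
an exponential tilt by a Gaussian variable. -/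
theorem exists_eq_tilted [CompleteSpace H] (hμ : HasGaussianFieldLaw e m μ)
    (hν : HasGaussianFieldLaw e m' ν) {u : H} (hu : ∀ s, m' s - m s = inner ℝ u (e s)) :
    ∃ (ξ : (S → ℝ) → ℝ) (v : ℝ≥0), Measurable ξ ∧ √(v : ℝ) ≤ ‖u‖ ∧
      μ.map ξ = gaussianReal 0 v ∧ ν = μ.tilted ξ := by
  have := hμ.isProbabilityMeasure
  have := hν.isProbabilityMeasure
  set E := Finsupp.linearCombination ℝ e with hE
  have huE : ∀ c : S →₀ ℝ, Finsupp.linearCombination ℝ m' c - Finsupp.linearCombination ℝ m c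
      = inner ℝ u (E c) := by
    intro c
    simp only [hE, Finsupp.linearCombination_apply, Finsupp.sum, inner_sum, inner_smul_right,
      ← Finset.sum_sub_distrib, ← hu, smul_eq_mul, mul_sub]
  -- Only the projection of `u` to the closed span of the `e s` affects the means, and it is a limit
  -- of finite combinations.
  set K : Submodule ℝ H := (LinearMap.range E).topologicalClosure with hK
  have hKc : CompleteSpace K :=
    (Submodule.isClosed_topologicalClosure _).completeSpace_coe
  set p : H := K.starProjection u with hp
  have hpu : ‖p‖ ≤ ‖u‖ := K.norm_starProjection_apply_le u
  have hpE : ∀ c, inner ℝ p (E c) = inner ℝ u (E c) := by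
    intro c
    have hmem : E c ∈ K := Submodule.le_topologicalClosure _ ⟨c, rfl⟩
    have := K.starProjection_inner_eq_zero u (E c) hmem
    rw [inner_sub_left] at this
    linarith
  have hpK : p ∈ closure (Set.range E) := by
    have : p ∈ K := K.starProjection_apply_mem u
    rwa [hK, ← SetLike.mem_coe, Submodule.topologicalClosure_coe] at this
  obtain ⟨x, hxr, hx⟩ := mem_closure_iff_seq_limit.1 hpK
  choose c hc using hxr
  -- The isometry `embed` carries the approximations of `p` to a Cauchy sequence in `L²`. Its limit
  -- `Z` is the log-likelihood ratio up to a constant.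
  have hcauchy : CauchySeq fun k => hμ.embed (c k) := by
    have hxc := hx.cauchySeq
    rw [Metric.cauchySeq_iff] at hxc ⊢
    intro ε hε
    obtain ⟨N, hN⟩ := hxc ε hε
    refine ⟨N, fun k hk l hl => ?_⟩
    have := hN k hk l hl
    rwa [dist_eq_norm, ← hc, ← hc, ← map_sub, ← hμ.norm_embed, map_sub, ← dist_eq_norm] at this
  obtain ⟨Z, hZ⟩ := cauchySeq_tendsto_of_complete hcauchy
  have hlim : ∀ d : S →₀ ℝ, Tendsto (fun k => hμ.embed (c k + d)) atTop (𝓝 (Z + hμ.embed d)) := by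
    intro d
    simp_rw [map_add]
    exact hZ.add_const _
  have hG : ∀ d, HasGaussianLaw (Z + hμ.embed d : Lp ℝ 2 μ) μ := fun d =>
    HasGaussianLaw.of_tendsto_Lp (fun k => hμ.hasGaussianLaw_embed _) (hlim d)
  have hM : ∀ d, ∫ y, (Z + hμ.embed d : Lp ℝ 2 μ) y ∂μ = 0 := by
    intro d
    refine tendsto_nhds_unique ((Lp.continuous_integral.tendsto _).comp (hlim d)) ?_
    simp only [Function.comp_def, hμ.integral_embed, tendsto_const_nhds]
  have hN : ∀ d, ‖Z + hμ.embed d‖ = ‖p + E d‖ := by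
    intro d
    refine tendsto_nhds_unique (hlim d).norm ?_
    simp_rw [hμ.norm_embed]
    simp_rw [← hE, map_add, hc]
    exact (hx.add_const _).norm
  set ξ := (Lp.aestronglyMeasurable Z).aemeasurable.mk Z with hξ
  have hξm : Measurable ξ := (Lp.aestronglyMeasurable Z).aemeasurable.measurable_mk
  have hξZ : Z =ᵐ[μ] ξ := (Lp.aestronglyMeasurable Z).aemeasurable.ae_eq_mk
  have hexp : ∀ d, ∫ y, Real.exp (centered m d y + ξ y) ∂μ = Real.exp (‖p + E d‖ ^ 2 / 2) := by
    intro d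
    rw [← hN, ← integral_exp_eq_of_gaussian (hG d) (hM d)]
    refine integral_congr_ae ?_
    filter_upwards [hξZ, Lp.coeFn_add Z (hμ.embed d), hμ.coeFn_embed d] with y h1 h2 h3
    rw [h2, Pi.add_apply, h3, h1, add_comm]
  have hlaw : μ.map ξ = gaussianReal 0 (‖p‖₊ ^ 2) := by
    have h1 := (hG 0).map_eq_gaussianReal
    rw [hM, Lp.variance_eq_norm_sq_sub, hM, hN] at h1
    simp only [map_zero, add_zero] at h1
    rw [← Measure.map_congr hξZ, h1]
    congr 1
    ext
    simp
  refine ⟨ξ, ‖p‖₊ ^ 2, hξm, by simpa using hpu, hlaw, ?_⟩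
  have hi : Integrable (fun y => Real.exp (ξ y)) μ := by
    refine integrable_exp_of_integral_ne_zero (r := ‖p‖ ^ 2 / 2) ?_
    simpa [centered] using hexp 0
  have := isProbabilityMeasure_tilted hi
  refine ext_of_map_linearCombination fun d => ?_
  rw [hν d]
  have hmean : Finsupp.linearCombination ℝ m' d
      = Finsupp.linearCombination ℝ m d + inner ℝ p (E d) := by
    rw [hpE, ← huE]
    ring
  rw [hmean]
  -- Expanding `‖p + t • E d‖²` exhibits `⟪p, E d⟫` as the covariance of `ξ` with the combination
  -- `d`, which is exactly the required shift of the mean.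
  refine (map_tilted_eq_gaussianReal (d := ‖p‖ ^ 2) (by fun_prop) fun t => ?_).symm
  have h1 := hexp (t • d)
  have h2 : ∀ y, t * Finsupp.linearCombination ℝ y d + ξ y
      = t * Finsupp.linearCombination ℝ m d + (centered m (t • d) y + ξ y) := by
    intro y
    simp only [centered, map_smul, smul_eq_mul]
    ring
  simp_rw [h2]
  simp_rw [Real.exp_add (t * _)]
  rw [integral_const_mul, h1, map_smul, norm_add_sq_real, inner_smul_right, norm_smul, mul_pow,
    Real.norm_eq_abs, sq_abs]
  congr 3
  simp only [NNReal.coe_pow, coe_nnnorm]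
  ring

/-- If `A` has probability at least `1 - α` under one Gaussian field law, then it has probability
at least `1 / 2` under every law shifted by a distance of at most `z_α`. -/
theorem half_le_of_shift [CompleteSpace H] (hμ : HasGaussianFieldLaw e m μ)
    (hν : HasGaussianFieldLaw e m' ν) {u : H} (hu : ∀ s, m' s - m s = inner ℝ u (e s))
    {α : ℝ} (h0 : 0 < α) (h1 : α < 1 / 2) (hnorm : ‖u‖ ≤ normalQuantile α) {A : Set (S → ℝ)}
    (hA : MeasurableSet A) (hcov : 1 - α ≤ ν.real A) : 1 / 2 ≤ μ.real A := by
  have := hμ.isProbabilityMeasure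
  obtain ⟨ξ, v, hξ, hv, hlaw, rfl⟩ := hμ.exists_eq_tilted hν hu
  exact half_le_of_tilted_gaussian hξ hlaw h0 h1 (hv.trans hnorm) hA hcov

end HasGaussianFieldLaw

end CameronMartin

/-! ### Gaussian observation models -/

section Model

variable {S H : Type*} [NormedAddCommGroup H] [InnerProductSpace ℝ H]

/-- An observation model with data indexed by `S` whose laws, for parameters in `D`, are Gaussian
field laws with a common covariance structure `e`, the means being shifted by at most `√n` times
the distance of the parameters. -/
structure IsGaussianModel (D : Set (S → ℝ)) (e : S → H) (mean : (S → ℝ) → S → ℝ) (n : ℝ)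
    (norm2 : (S → ℝ) → ℝ≥0∞) (law : (S → ℝ) → Measure (S → ℝ)) : Prop where
  hasGaussianFieldLaw : ∀ f ∈ D, HasGaussianFieldLaw e (mean f) (law f)
  exists_shift : ∀ f ∈ D, ∀ g ∈ D, ∀ ε : ℝ, 0 ≤ ε → norm2 (g - f) ≤ ENNReal.ofReal ε →
    ∃ u : H, ‖u‖ ≤ √n * ε ∧ ∀ s, mean g s - mean f s = inner ℝ u (e s)
  norm_smul_le : ∀ (r : ℝ) (x : S → ℝ), norm2 (r • x) ≤ ENNReal.ofReal |r| * norm2 x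

lemma IsLinearEstimator.hasGaussianLaw {e : S → H} {law : (S → ℝ) → Measure (S → ℝ)}
    {G : Set (S → ℝ)} {That : (S → ℝ) → ℝ} (h : IsLinearEstimator law G That) {f m : S → ℝ}
    (hf : f ∈ G) (hlaw : HasGaussianFieldLaw e m (law f)) : HasGaussianLaw That (law f) := by
  have := hlaw.isProbabilityMeasure
  obtain ⟨a, c, hc⟩ := h.limit
  refine HasGaussianLaw.of_tendsto_eLpNorm h.measurable.aestronglyMeasurable (fun k => ?_) (hc f hf)
  constructor
  have : (fun y : S → ℝ => a + (c k).sum fun s r => r * y s)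
      = (fun x => a + x) ∘ fun y => Finsupp.linearCombination ℝ y (c k) := rfl
  rw [this, ← Measure.map_map (by fun_prop) (by fun_prop), hlaw, gaussianReal_map_const_add]
  infer_instance

/-- Taking `f = g` at a common point makes the modulus set nonempty and, once it is bounded above,
the modulus nonnegative. -/
lemma zero_mem_modulusSet {norm2 : (S → ℝ) → ℝ≥0∞} (h0 : norm2 0 = 0) (T : (S → ℝ) →ₗ[ℝ] ℝ)
    (ε : ℝ) {F G : Set (S → ℝ)} (hFG : (F ∩ G).Nonempty) : 0 ∈ modulusSet norm2 T ε F G := by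
  obtain ⟨h, hF, hG⟩ := hFG
  exact ⟨h, hF, h, hG, by simp [h0], by simp⟩

lemma volume_ge_of_mem_of_mem {C : Set ℝ} (hC : C.OrdConnected) {a b : ℝ} (ha : a ∈ C)
    (hb : b ∈ C) : ENNReal.ofReal |b - a| ≤ volume C := by
  rw [← Real.volume_interval]
  exact measure_mono (hC.uIcc_subset ha hb)

lemma IsIntervalProcedure.measurableSet_mem {C : (S → ℝ) → Set ℝ} (hC : IsIntervalProcedure C)
    (a : ℝ) : MeasurableSet {y | a ∈ C y} :=
  hC.measurableSet_graph.preimage (measurable_id.prodMk measurable_const)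

variable {D : Set (S → ℝ)} {e : S → H} {mean : (S → ℝ) → S → ℝ} {n : ℝ}
  {norm2 : (S → ℝ) → ℝ≥0∞} {law : (S → ℝ) → Measure (S → ℝ)} {T : (S → ℝ) →ₗ[ℝ] ℝ} {α : ℝ}
  {G : Set (S → ℝ)}

lemma IsGaussianModel.norm_zero (h : IsGaussianModel D e mean n norm2 law) : norm2 0 = 0 := by
  simpa using h.norm_smul_le 0 0

lemma real_ge_of_mem_confidenceIntervals {C : (S → ℝ) → Set ℝ}
    (hC : C ∈ confidenceIntervals law T α G) {f : S → ℝ} (hf : f ∈ G)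
    [IsProbabilityMeasure (law f)] : 1 - α ≤ (law f).real {y | T f ∈ C y} := by
  rw [measureReal_def]
  exact (ENNReal.ofReal_le_iff_le_toReal (measure_ne_top _ _)).1 (hC.2 f hf)

/-- The two-point lower bound for the expected length of a confidence interval. -/
lemma IsGaussianModel.lintegral_volume_ge [CompleteSpace H]
    (h : IsGaussianModel D e mean n norm2 law)
    (hn : 0 < n) (h0 : 0 < α) (h1 : α < 1 / 2) (hGD : G ⊆ D) {C : (S → ℝ) → Set ℝ}
    (hC : C ∈ confidenceIntervals law T α G) {f g : S → ℝ} (hf : f ∈ G) (hg : g ∈ G)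
    (hfg : norm2 (g - f) ≤ ENNReal.ofReal (normalQuantile α / √n)) :
    ENNReal.ofReal ((1 / 2 - α) * |T g - T f|) ≤ ∫⁻ y, volume (C y) ∂(law f) := by
  have hlf := h.hasGaussianFieldLaw f (hGD hf)
  have hlg := h.hasGaussianFieldLaw g (hGD hg)
  have := hlf.isProbabilityMeasure
  have := hlg.isProbabilityMeasure
  have hsn : 0 < √n := Real.sqrt_pos.2 hn
  obtain ⟨u, hu, hmean⟩ := h.exists_shift f (hGD hf) g (hGD hg) _
    (div_nonneg (normalQuantile_pos h0 h1).le hsn.le) hfg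
  rw [mul_div_cancel₀ _ hsn.ne'] at hu
  have hmf := hC.1.measurableSet_mem (T f)
  have hmg := hC.1.measurableSet_mem (T g)
  have hpf := real_ge_of_mem_confidenceIntervals hC hf
  have hpg := hlf.half_le_of_shift hlg hmean h0 h1 hu hmg
    (real_ge_of_mem_confidenceIntervals hC hg)
  set A : Set (S → ℝ) := {y | T f ∈ C y} ∩ {y | T g ∈ C y} with hA
  have hpA : 1 / 2 - α ≤ (law f).real A := by
    have h2 := measureReal_union_add_inter (μ := law f) (s := {y | T f ∈ C y}) hmg
    have h3 : (law f).real ({y | T f ∈ C y} ∪ {y | T g ∈ C y}) ≤ 1 := measureReal_le_one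
    linarith
  have hle : ∀ y, A.indicator (fun _ => ENNReal.ofReal |T g - T f|) y ≤ volume (C y) := by
    intro y
    by_cases hy : y ∈ A
    · rw [Set.indicator_of_mem hy]
      exact volume_ge_of_mem_of_mem (hC.1.ordConnected y) hy.1 hy.2
    · simp [Set.indicator_of_notMem hy]
  refine le_trans ?_ (lintegral_mono hle)
  rw [lintegral_indicator_const (hmf.inter hmg), mul_comm (1 / 2 - α),
    ENNReal.ofReal_mul (abs_nonneg _)]
  gcongr
  rw [← ofReal_measureReal]
  exact ENNReal.ofReal_le_ofReal hpA

/-- The lower bound for the maximum expected length through the ordered modulus at the larger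
radius `z_{α/2} / √n`. -/
lemma IsGaussianModel.ofReal_le_maxExpectedLength [CompleteSpace H]
    (h : IsGaussianModel D e mean n norm2 law)
    (hn : 0 < n) (h0 : 0 < α) (h1 : α < 1 / 2) (hGD : G ⊆ D) {C : (S → ℝ) → Set ℝ}
    (hC : C ∈ confidenceIntervals law T α G) {F₁ F₂ F : Set (S → ℝ)} (hF₁ : F₁ ⊆ G)
    (hF₂ : F₂ ⊆ G) (hc₁ : Convex ℝ F₁) (hc₂ : Convex ℝ F₂) (hne : (F₁ ∩ F₂).Nonempty)
    (hF : F = F₁ ∨ F = F₂) {d : ℝ}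
    (hd : d ∈ modulusSet norm2 T (normalQuantile (α / 2) / √n) F₁ F₂) :
    ENNReal.ofReal ((1 / 2 - α) * (normalQuantile α / normalQuantile (α / 2)) * d)
      ≤ maxExpectedLength law C F := by
  obtain ⟨f, hf, g, hg, hfg, rfl⟩ := hd
  obtain ⟨p, hp₁, hp₂⟩ := hne
  have hz := normalQuantile_pos h0 h1
  have hz2 := hz.trans_le (normalQuantile_le_half h0 (by linarith))
  -- Contraction by `r` towards `p` brings the pair from distance `z_{α/2} / √n` to `z_α / √n` and
  -- multiplies the difference of `T` by `r`.
  set r := normalQuantile α / normalQuantile (α / 2) with hr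
  have hr0 : 0 < r := div_pos hz hz2
  have hr1 : r ≤ 1 := (div_le_one hz2).2 (normalQuantile_le_half h0 (by linarith))
  set f' := r • f + (1 - r) • p with hf'
  set g' := r • g + (1 - r) • p with hg'
  have hf'F : f' ∈ F₁ := hc₁ hf hp₁ hr0.le (by linarith) (by ring)
  have hg'F : g' ∈ F₂ := hc₂ hg hp₂ hr0.le (by linarith) (by ring)
  have hdiff : T g' - T f' = r * (T g - T f) := by
    simp only [hf', hg', map_add, map_smul, smul_eq_mul]
    ring
  have hnorm : ∀ t : ℝ, |t| = r →
      norm2 (t • (g - f)) ≤ ENNReal.ofReal (normalQuantile α / √n) := by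
    intro t ht
    refine (h.norm_smul_le t _).trans ?_
    rw [ht]
    refine (mul_le_mul_right hfg _).trans_eq ?_
    rw [← ENNReal.ofReal_mul hr0.le]
    congr 1
    rw [hr]
    field_simp
  have hle : (1 / 2 - α) * r * (T g - T f) ≤ (1 / 2 - α) * |T g' - T f'| := by
    rw [hdiff, mul_assoc]
    exact mul_le_mul_of_nonneg_left (le_abs_self _) (by linarith)
  refine (ENNReal.ofReal_le_ofReal hle).trans ?_
  -- The two-point bound is symmetric, so the length is evaluated at whichever of `f'`, `g'` lies in
  -- `F`.
  rcases hF with rfl | rfl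
  · refine le_trans ?_ (le_iSup₂ (f := fun f (_ : f ∈ F) => ∫⁻ y, volume (C y) ∂(law f)) f' hf'F)
    refine h.lintegral_volume_ge hn h0 h1 hGD hC (hF₁ hf'F) (hF₂ hg'F) ?_
    have : g' - f' = r • (g - f) := by
      rw [hf', hg', smul_sub]
      abel
    rw [this]
    exact hnorm r (abs_of_pos hr0)
  · refine le_trans ?_ (le_iSup₂ (f := fun f (_ : f ∈ F) => ∫⁻ y, volume (C y) ∂(law f)) g' hg'F)
    rw [abs_sub_comm]
    refine h.lintegral_volume_ge hn h0 h1 hGD hC (hF₂ hg'F) (hF₁ hf'F) ?_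
    have : f' - g' = (-r) • (g - f) := by
      rw [hf', hg', neg_smul, smul_sub]
      abel
    rw [this]
    exact hnorm (-r) (by rw [abs_neg, abs_of_pos hr0])

end Model

/-! ### The adaptive interval -/

section Adaptive

variable {S H : Type*} [NormedAddCommGroup H] [InnerProductSpace ℝ H]
  {D : Set (S → ℝ)} {e : S → H} {mean : (S → ℝ) → S → ℝ} {n : ℝ}
  {norm2 : (S → ℝ) → ℝ≥0∞} {law : (S → ℝ) → Measure (S → ℝ)} {T : (S → ℝ) →ₗ[ℝ] ℝ} {α : ℝ}
  {G : Set (S → ℝ)} {k : ℕ} {F : Fin k → Set (S → ℝ)} {w : Fin k → Fin k → ℝ}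
  {That : Fin k → Fin k → (S → ℝ) → ℝ} {j : Fin k}

lemma isIntervalProcedure_adaptiveInterval (h₁ : ∀ i, Measurable (That i j))
    (h₂ : ∀ i, Measurable (That j i)) : IsIntervalProcedure (adaptiveInterval That w j) where
  ordConnected _ := Set.ordConnected_Icc
  measurableSet_graph := by
    have hL : Measurable fun y => ⨅ i, (That i j y - 3 / 2 * w i j) :=
      Measurable.iInf fun i => (h₁ i).sub_const _
    have hU : Measurable fun y => ⨆ i, (That j i y + 3 / 2 * w j i) :=
      Measurable.iSup fun i => (h₂ i).add_const _
    exact (measurableSet_le (hL.comp measurable_fst) measurable_snd).inter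
      (measurableSet_le measurable_snd (hU.comp measurable_fst))

/-- The law of a balanced estimator is Gaussian with a small variance. -/
lemma IsBalancedEstimator.exists_map_eq (h : IsGaussianModel D e mean n norm2 law) (hGD : G ⊆ D)
    (hz : 0 < normalQuantile (α / 2)) {b : ℝ} {F₁ F₂ : Set (S → ℝ)}
    {X : (S → ℝ) → ℝ} (hX : IsBalancedEstimator law T α G b F₁ F₂ X) {f : S → ℝ} (hf : f ∈ G) :
    ∃ v : ℝ≥0, (law f).map X = gaussianReal (∫ y, X y ∂(law f)) v ∧
      (v : ℝ) ≤ (b / normalQuantile (α / 2)) ^ 2 := by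
  have hg := hX.linear.hasGaussianLaw hf (h.hasGaussianFieldLaw f (hGD hf))
  refine ⟨_, hg.map_eq_gaussianReal, ?_⟩
  rw [Real.coe_toNNReal _ (variance_nonneg _ _)]
  refine (hX.variance_le f hf).trans_eq ?_
  field_simp

lemma sqrt_mul_le_of_le_div_sq {v : ℝ≥0} {b z : ℝ} (hz : 0 < z) (hb : 0 ≤ b)
    (h : (v : ℝ) ≤ (b / z) ^ 2) : √(v : ℝ) * z ≤ b := by
  have := Real.sqrt_le_sqrt h
  rw [Real.sqrt_sq (div_nonneg hb hz.le)] at this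
  rwa [← le_div_iff₀ hz]

/-- The mean of `X + 3/2 * b` exceeds `T f` by at least `b`, and `b` is at least `z_{α/2}` standard
deviations. -/
lemma IsBalancedEstimator.measure_upper_lt_le (h : IsGaussianModel D e mean n norm2 law)
    (hGD : G ⊆ D) (h0 : 0 < α) (h1 : α < 1 / 2) {b : ℝ} (hb : 0 ≤ b) {F₁ F₂ : Set (S → ℝ)}
    {X : (S → ℝ) → ℝ} (hX : IsBalancedEstimator law T α G b F₁ F₂ X) {f : S → ℝ} (hf : f ∈ G)
    (hf₂ : f ∈ F₂) :
    law f {y | X y + 3 / 2 * b < T f} ≤ ENNReal.ofReal (α / 2) := by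
  have hz := normalQuantile_pos (half_pos h0) (by linarith)
  obtain ⟨v, hv, hvle⟩ := hX.exists_map_eq h hGD hz hf
  have := measure_lt_le_of_gaussian hX.linear.measurable (half_pos h0) (by linarith) hv
    (b := T f - 3 / 2 * b) (by
      have := sqrt_mul_le_of_le_div_sq hz hb hvle
      have := hX.bias_ge f hf₂
      linarith)
  simpa only [lt_sub_iff_add_lt] using this

lemma IsBalancedEstimator.measure_lt_lower_le (h : IsGaussianModel D e mean n norm2 law)
    (hGD : G ⊆ D) (h0 : 0 < α) (h1 : α < 1 / 2) {b : ℝ} (hb : 0 ≤ b) {F₁ F₂ : Set (S → ℝ)}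
    {X : (S → ℝ) → ℝ} (hX : IsBalancedEstimator law T α G b F₁ F₂ X) {f : S → ℝ} (hf : f ∈ G)
    (hf₁ : f ∈ F₁) :
    law f {y | T f < X y - 3 / 2 * b} ≤ ENNReal.ofReal (α / 2) := by
  have hz := normalQuantile_pos (half_pos h0) (by linarith)
  obtain ⟨v, hv, hvle⟩ := hX.exists_map_eq h hGD hz hf
  have hneg : (law f).map (fun y => -X y) = gaussianReal (-∫ y, X y ∂(law f)) v := by
    have : (fun y => -X y) = (fun x => -x) ∘ X := rfl
    rw [this, ← Measure.map_map measurable_neg hX.linear.measurable, hv, gaussianReal_map_neg]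
  have := measure_lt_le_of_gaussian hX.linear.measurable.neg (half_pos h0) (by linarith) hneg
    (b := -(T f + 3 / 2 * b)) (by
      have := sqrt_mul_le_of_le_div_sq hz hb hvle
      have := hX.bias_le f hf₁
      linarith)
  refine (measure_mono fun y hy => ?_).trans this
  have hy' : T f < X y - 3 / 2 * b := hy
  change -X y < -(T f + 3 / 2 * b)
  linarith

/-- If `f ∈ F i`, failure of the whole interval forces failure of one of the two endpoints with
index `i`. No union bound over all indices is needed, so `k` costs nothing in coverage. -/
lemma adaptiveInterval_mem_confidenceIntervals (h : IsGaussianModel D e mean n norm2 law)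
    (hGD : G ⊆ D) (hG : G = ⋃ i, F i) (h0 : 0 < α) (h1 : α < 1 / 2)
    (hw : ∀ i l, i = j ∨ l = j → 0 ≤ w i l)
    (hThat : ∀ i l, i = j ∨ l = j →
      IsBalancedEstimator law T α G (w i l) (F i) (F l) (That i l)) :
    adaptiveInterval That w j ∈ confidenceIntervals law T α G := by
  have hproc := isIntervalProcedure_adaptiveInterval (w := w) (j := j)
    (fun i => (hThat i j (Or.inr rfl)).linear.measurable)
    (fun i => (hThat j i (Or.inl rfl)).linear.measurable)
  refine ⟨hproc, fun f hf => ?_⟩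
  have := (h.hasGaussianFieldLaw f (hGD hf)).isProbabilityMeasure
  obtain ⟨i, hi⟩ := Set.mem_iUnion.1 (hG ▸ hf)
  have hup := (hThat j i (Or.inl rfl)).measure_upper_lt_le h hGD h0 h1 (hw j i (Or.inl rfl)) hf hi
  have hlo := (hThat i j (Or.inr rfl)).measure_lt_lower_le h hGD h0 h1 (hw i j (Or.inr rfl)) hf hi
  have hsub : {y | T f ∈ adaptiveInterval That w j y}ᶜ ⊆
      {y | That j i y + 3 / 2 * w j i < T f} ∪ {y | T f < That i j y - 3 / 2 * w i j} := by
    intro y hy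
    by_contra hn
    simp only [Set.mem_union, not_or] at hn
    refine hy ⟨?_, ?_⟩
    · exact (ciInf_le (Set.finite_range _).bddBelow i).trans (not_lt.1 hn.2)
    · exact (not_lt.1 hn.1).trans (le_ciSup (f := fun i => That j i y + 3 / 2 * w j i)
        (Set.finite_range _).bddAbove i)
  have hcompl : law f {y | T f ∈ adaptiveInterval That w j y}ᶜ ≤ ENNReal.ofReal α := by
    refine (measure_mono hsub).trans ((measure_union_le _ _).trans ((add_le_add hup hlo).trans_eq ?_))
    rw [← ENNReal.ofReal_add (half_pos h0).le (half_pos h0).le, add_halves]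
  have hm := hproc.measurableSet_mem (T f)
  rw [prob_compl_eq_one_sub hm, tsub_le_iff_right] at hcompl
  rw [ENNReal.ofReal_sub _ h0.le, ENNReal.ofReal_one, tsub_le_iff_left]
  exact hcompl

/-- The expected length of the adaptive interval over `F j` is controlled by any bound for the
moduli. -/
lemma maxExpectedLength_adaptiveInterval_le (h : IsGaussianModel D e mean n norm2 law)
    (hGD : G ⊆ D) (hG : G = ⋃ i, F i) (h0 : 0 < α) (h1 : α < 1 / 2)
    (hw : ∀ i l, i = j ∨ l = j → 0 ≤ w i l)
    (hThat : ∀ i l, i = j ∨ l = j →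
      IsBalancedEstimator law T α G (w i l) (F i) (F l) (That i l))
    {b : ℝ} (hwb : ∀ i l, i = j ∨ l = j → w i l ≤ b) :
    maxExpectedLength law (adaptiveInterval That w j) (F j)
      ≤ ENNReal.ofReal (2 *
        (2 * b + b / normalQuantile (α / 2) * √(2 * Real.log (k + 1)))) := by
  have hz := normalQuantile_pos (half_pos h0) (by linarith)
  have hb : 0 ≤ b := (hw j j (Or.inl rfl)).trans (hwb j j (Or.inl rfl))
  have : Nonempty (Fin k) := ⟨j⟩
  have hvb : ∀ i l, i = j ∨ l = j →
      (w i l / normalQuantile (α / 2)) ^ 2 ≤ (b / normalQuantile (α / 2)) ^ 2 := by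
    intro i l hil
    have h3 := hw i l hil
    have h4 := hwb i l hil
    gcongr
  refine iSup₂_le fun f hfj => ?_
  have hf : f ∈ G := hG ▸ Set.mem_iUnion.2 ⟨j, hfj⟩
  have := (h.hasGaussianFieldLaw f (hGD hf)).isProbabilityMeasure
  -- The length is split at `T f`, with `U` the upper overshoots and `V` the lower ones. Their means
  -- are at most `b/2 + 3b/2 = 2b`.
  set U : Fin k → (S → ℝ) → ℝ := fun i y => That j i y + (3 / 2 * w j i - T f) with hU
  set V : Fin k → (S → ℝ) → ℝ := fun i y => (T f + 3 / 2 * w i j) - That i j y with hV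
  choose vU hvU hvU' using fun i => (hThat j i (Or.inl rfl)).exists_map_eq h hGD hz hf
  choose vV hvV hvV' using fun i => (hThat i j (Or.inr rfl)).exists_map_eq h hGD hz hf
  have hmU : ∀ i, (law f).map (U i)
      = gaussianReal (∫ y, That j i y ∂(law f) + (3 / 2 * w j i - T f)) (vU i) := by
    intro i
    have : U i = (fun x => x + (3 / 2 * w j i - T f)) ∘ That j i := rfl
    rw [this, ← Measure.map_map (by fun_prop) (hThat j i (Or.inl rfl)).linear.measurable, hvU,
      gaussianReal_map_add_const]
  have hmV : ∀ i, (law f).map (V i)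
      = gaussianReal ((T f + 3 / 2 * w i j) - ∫ y, That i j y ∂(law f)) (vV i) := by
    intro i
    have : V i = (fun x => (T f + 3 / 2 * w i j) - x) ∘ That i j := rfl
    rw [this, ← Measure.map_map (by fun_prop) (hThat i j (Or.inr rfl)).linear.measurable, hvV,
      gaussianReal_map_const_sub]
  have hIU := lintegral_iSup_gaussian_le hmU (a := 2 * b) (by linarith) (div_nonneg hb hz.le)
    (fun i => by
      have h3 := (hThat j i (Or.inl rfl)).bias_le f hfj
      have h4 := hwb j i (Or.inl rfl)
      linarith) (fun i => (hvU' i).trans (hvb j i (Or.inl rfl)))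
  have hIV := lintegral_iSup_gaussian_le hmV (a := 2 * b) (by linarith) (div_nonneg hb hz.le)
    (fun i => by
      have h3 := (hThat i j (Or.inr rfl)).bias_ge f hfj
      have h4 := hwb i j (Or.inr rfl)
      linarith) (fun i => (hvV' i).trans (hvb i j (Or.inr rfl)))
  have hmeas : Measurable fun y => ENNReal.ofReal (⨆ i, U i y) :=
    (Measurable.iSup fun i =>
      (hThat j i (Or.inl rfl)).linear.measurable.add_const _).ennreal_ofReal
  have hle : ∀ y, volume (adaptiveInterval That w j y)
      ≤ ENNReal.ofReal (⨆ i, U i y) + ENNReal.ofReal (⨆ i, V i y) := by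
    intro y
    rw [adaptiveInterval, Real.volume_Icc]
    refine (ENNReal.ofReal_le_ofReal ?_).trans ENNReal.ofReal_add_le
    obtain ⟨i, hi⟩ := exists_eq_ciSup_of_finite (f := fun i => That j i y + 3 / 2 * w j i)
    obtain ⟨l, hl⟩ := exists_eq_ciInf_of_finite (f := fun i => That i j y - 3 / 2 * w i j)
    rw [← hi, ← hl]
    have h3 := le_ciSup (f := fun i => U i y) (Set.finite_range _).bddAbove i
    have h4 := le_ciSup (f := fun i => V i y) (Set.finite_range _).bddAbove l
    simp only [hU, hV] at h3 h4 ⊢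
    linarith
  refine (lintegral_mono hle).trans ?_
  rw [lintegral_add_left hmeas]
  refine (add_le_add hIU hIV).trans_eq ?_
  rw [Fintype.card_fin, ← ENNReal.ofReal_add (by positivity) (by positivity), two_mul (2 * b + _)]

/-- In every Gaussian model the adaptive interval has the required coverage, and its maximum
expected length is within a logarithmic factor of the benchmark. -/
theorem IsGaussianModel.adaptiveInterval_optimal [CompleteSpace H]
    (h : IsGaussianModel D e mean n norm2 law) (hn : 0 < n) (h0 : 0 < α) (h1 : α < 1 / 2)
    (hGD : G ⊆ D) (hconv : ∀ i, Convex ℝ (F i)) (hne : ∀ i l, (F i ∩ F l).Nonempty)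
    (hG : G = ⋃ i, F i)
    (hw : ∀ i l, w i l = orderedModulus norm2 T (normalQuantile (α / 2) / √n) (F i) (F l))
    (hbdd : ∀ i l, i = j ∨ l = j →
      BddAbove (modulusSet norm2 T (normalQuantile (α / 2) / √n) (F i) (F l)))
    (hThat : ∀ i l, i = j ∨ l = j →
      IsBalancedEstimator law T α G (w i l) (F i) (F l) (That i l)) :
    adaptiveInterval That w j ∈ confidenceIntervals law T α G ∧
    optimalExpectedLength law T α (F j) G
      ≤ maxExpectedLength law (adaptiveInterval That w j) (F j) ∧
    maxExpectedLength law (adaptiveInterval That w j) (F j)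
      ≤ ENNReal.ofReal (lengthFactor k α) * optimalExpectedLength law T α (F j) G := by
  have hw0 : ∀ i l, i = j ∨ l = j → 0 ≤ w i l := fun i l hil => by
    rw [hw]
    exact le_csSup (hbdd i l hil) (zero_mem_modulusSet h.norm_zero T _ (hne i l))
  have hmem := adaptiveInterval_mem_confidenceIntervals h hGD hG h0 h1 hw0 hThat
  refine ⟨hmem, iInf₂_le _ hmem, ?_⟩
  have hz := normalQuantile_pos h0 h1
  have hz2 := normalQuantile_pos (half_pos h0) (show α / 2 < 1 / 2 by linarith)
  have hα : 0 < 1 / 2 - α := by linarith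
  have hsub : ∀ i, F i ⊆ G := fun i => hG ▸ Set.subset_iUnion F i
  have hk : (1 : ℝ) < k + 1 := by
    have : (0 : ℝ) < k := by exact_mod_cast j.pos
    linarith
  have hlog : 0 < Real.log (k + 1) := Real.log_pos hk
  have hfac : 0 < lengthFactor k α := by
    unfold lengthFactor
    positivity
  set L := optimalExpectedLength law T α (F j) G with hL
  by_cases hLtop : L = ⊤
  · rw [hLtop, ENNReal.mul_top (by simpa using hfac)]
    exact le_top
  set q := (1 / 2 - α) * (normalQuantile α / normalQuantile (α / 2)) with hq
  have hq0 : 0 < q := by positivity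
  -- Each element of the modulus set, multiplied by `q`, bounds the maximum length of every
  -- admissible procedure from below, hence also the infimum `L`.
  have hwL : ∀ i l, i = j ∨ l = j → w i l ≤ L.toReal / q := by
    intro i l hil
    rw [hw]
    refine csSup_le ⟨0, zero_mem_modulusSet h.norm_zero T _ (hne i l)⟩ fun d hd => ?_
    rw [le_div_iff₀ hq0, mul_comm, ← ENNReal.ofReal_le_iff_le_toReal hLtop]
    refine le_iInf₂ fun C hC => ?_
    exact h.ofReal_le_maxExpectedLength hn h0 h1 hGD hC (hsub i) (hsub l) (hconv i) (hconv l)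
      (hne i l) (by rcases hil with rfl | rfl <;> simp) hd
  refine (maxExpectedLength_adaptiveInterval_le h hGD hG h0 h1 hw0 hThat hwL).trans ?_
  rw [← ENNReal.ofReal_toReal hLtop, ← ENNReal.ofReal_mul hfac.le,
    ENNReal.toReal_ofReal ENNReal.toReal_nonneg]
  refine ENNReal.ofReal_le_ofReal ?_
  -- Only `√2 ≤ 4` is used; the constant `8` is generous.
  have hsq : √(2 * Real.log (k + 1)) ≤ 4 * √(Real.log (k + 1)) := by
    rw [Real.sqrt_mul zero_le_two]
    refine mul_le_mul_of_nonneg_right ?_ (Real.sqrt_nonneg _)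
    exact Real.sqrt_le_iff.2 ⟨by norm_num, by norm_num⟩
  have hLr : 0 ≤ L.toReal := ENNReal.toReal_nonneg
  have heq : 2 * (2 * (L.toReal / q)
      + L.toReal / q / normalQuantile (α / 2) * √(2 * Real.log (k + 1)))
      = (4 * normalQuantile (α / 2) + 2 * √(2 * Real.log (k + 1)))
        / ((1 / 2 - α) * normalQuantile α) * L.toReal := by
    rw [hq]
    field_simp
    ring
  rw [heq, lengthFactor]
  gcongr ?_ / _ * _
  linarith

end Adaptive

/-! ### Laws of Gaussian processes -/

section GaussianProcess

variable {Ω S H : Type*} [MeasurableSpace Ω] {P : Measure Ω} [NormedAddCommGroup H]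
  [InnerProductSpace ℝ H]

/-- A finite combination is Gaussian, so mean and variance fix its law, and bilinearity of the
covariance turns the variance into `‖∑ c s • e s‖²`. -/
lemma ProbabilityTheory.IsGaussianProcess.hasGaussianFieldLaw {X : S → Ω → ℝ}
    (hX : IsGaussianProcess X P) (hXm : ∀ s, Measurable (X s)) {e : S → H} {a : S → ℝ}
    (hmean : ∀ s, ∫ ω, X s ω ∂P = a s)
    (hcov : ∀ s t, cov[X s, X t; P] = inner ℝ (e s) (e t)) (m : S → ℝ) :
    HasGaussianFieldLaw e (fun s => m s + a s) (P.map fun ω s => m s + X s ω) := by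
  intro c
  have := hX.isProbabilityMeasure
  have hL2 : ∀ s, MemLp (fun ω => c s * X s ω) 2 P := fun s =>
    (hX.hasGaussianLaw_eval s).memLp_two.const_mul (c s)
  have hG : HasGaussianLaw (fun ω => ∑ s ∈ c.support, c s * X s ω) P :=
    (hX.smul c).hasGaussianLaw_fun_sum
  have hmap := hG.map_eq_gaussianReal
  have h1 : ∫ ω, ∑ s ∈ c.support, c s * X s ω ∂P = ∑ s ∈ c.support, c s * a s := by
    rw [integral_finsetSum _ fun s _ => (hL2 s).integrable one_le_two]
    simp_rw [integral_const_mul, hmean]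
  have h2 : Var[fun ω => ∑ s ∈ c.support, c s * X s ω; P]
      = ‖Finsupp.linearCombination ℝ e c‖ ^ 2 := by
    rw [← covariance_self hG.aemeasurable, covariance_fun_sum_left' (fun s _ => hL2 s)
      hG.memLp_two, ← real_inner_self_eq_norm_sq, Finsupp.linearCombination_apply, Finsupp.sum,
      sum_inner]
    refine Finset.sum_congr rfl fun s _ => ?_
    rw [covariance_fun_sum_right' (fun s _ => hL2 s) (hL2 s), inner_sum]
    refine Finset.sum_congr rfl fun t _ => ?_
    rw [covariance_const_mul_left, covariance_const_mul_right, hcov, real_inner_smul_left,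
      real_inner_smul_right]
  rw [h1, h2] at hmap
  have hcomp : (fun y : S → ℝ => Finsupp.linearCombination ℝ y c) ∘ (fun ω s => m s + X s ω)
      = (fun x => ∑ s ∈ c.support, c s * m s + x) ∘ fun ω => ∑ s ∈ c.support, c s * X s ω := by
    ext ω
    simp [Finsupp.linearCombination_apply, Finsupp.sum, mul_add, Finset.sum_add_distrib]
  rw [Measure.map_map (by fun_prop) (by fun_prop), hcomp,
    ← Measure.map_map (by fun_prop) (by fun_prop), hmap, gaussianReal_map_const_add]
  congr 1
  · simp [Finsupp.linearCombination_apply, Finsupp.sum, mul_add, Finset.sum_add_distrib, add_comm]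
  · ext
    simp

end GaussianProcess

/-! ### The sequence model -/

section SequenceModel

variable {M : Type*}

lemma sequenceNorm_smul_le (r : ℝ) (x : M → ℝ) :
    sequenceNorm (r • x) ≤ ENNReal.ofReal |r| * sequenceNorm x := by
  unfold sequenceNorm
  have : ∀ i, ENNReal.ofReal ((r • x) i ^ 2) = ENNReal.ofReal |r| ^ 2 * ENNReal.ofReal (x i ^ 2) := by
    intro i
    rw [← ENNReal.ofReal_pow (abs_nonneg r), ← ENNReal.ofReal_mul (by positivity), sq_abs]
    simp [mul_pow]
  simp_rw [this]
  rw [ENNReal.tsum_mul_left, ENNReal.mul_rpow_of_nonneg _ _ (by norm_num)]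
  refine mul_le_mul_left (le_of_eq ?_) _
  rw [← ENNReal.rpow_natCast, ← ENNReal.rpow_mul]
  norm_num

lemma exists_lp_of_sequenceNorm_le {x : M → ℝ} {ε : ℝ} (hε : 0 ≤ ε)
    (h : sequenceNorm x ≤ ENNReal.ofReal ε) :
    ∃ u : lp (fun _ : M => ℝ) 2, (∀ i, u i = x i) ∧ ‖u‖ ≤ ε := by
  have h2 : ∑' i, ENNReal.ofReal (x i ^ 2) ≤ ENNReal.ofReal (ε ^ 2) := by
    have := ENNReal.rpow_le_rpow h (z := 2) (by norm_num)
    rw [sequenceNorm, ← ENNReal.rpow_mul] at this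
    norm_num at this
    rwa [← ENNReal.ofReal_pow hε] at this
  have hsum : Summable fun i => x i ^ 2 := by
    have := ENNReal.summable_toReal (h2.trans_lt ENNReal.ofReal_lt_top).ne
    simpa [ENNReal.toReal_ofReal, sq_nonneg] using this
  have hmem : Memℓp x 2 := by
    refine (memℓp_gen_iff (by norm_num)).2 ?_
    simpa using hsum
  refine ⟨⟨x, hmem⟩, fun i => rfl, ?_⟩
  rw [← ENNReal.ofReal_tsum_of_nonneg (fun i => sq_nonneg _) hsum,
    ENNReal.ofReal_le_ofReal_iff (sq_nonneg ε)] at h2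
  refine (sq_le_sq₀ (norm_nonneg _) hε).1 ?_
  have := lp.norm_rpow_eq_tsum (p := 2) (by norm_num) (⟨x, hmem⟩ : lp (fun _ : M => ℝ) 2)
  norm_num at this
  rw [this]
  exact h2

/-- Independent coordinates of variance `1/n` correspond to `e i = n^{-1/2} δ_i`, and the shift is
`u = √n (g - f)`. Only the difference `g - f` has to lie in `ℓ²`. -/
lemma isGaussianModel_sequence {n : ℝ} (hn : 0 < n) [DecidableEq M] :
    IsGaussianModel Set.univ (fun i : M => (√n)⁻¹ • (lp.single 2 i (1 : ℝ) : lp (fun _ : M => ℝ) 2))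
      (fun f => f) n sequenceNorm (sequenceLaw n) where
  norm_smul_le := sequenceNorm_smul_le
  exists_shift f _ g _ ε hε h := by
    obtain ⟨u, hu, hnorm⟩ := exists_lp_of_sequenceNorm_le hε h
    have hsn : 0 < √n := Real.sqrt_pos.2 hn
    refine ⟨√n • u, ?_, fun i => ?_⟩
    · rw [norm_smul, Real.norm_of_nonneg hsn.le]
      gcongr
    · rw [real_inner_smul_left, real_inner_smul_right, lp.inner_single_right, hu]
      simp
      field_simp
  hasGaussianFieldLaw f _ := by
    set μ := sequenceLaw n f with hμ
    have hprob : IsProbabilityMeasure μ := by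
      rw [hμ, sequenceLaw]
      infer_instance
    have heval : ∀ i, μ.map (fun y : M → ℝ => y i) = gaussianReal (f i) (Real.toNNReal (1 / n)) :=
      fun i => Measure.infinitePi_map_eval _ i
    have hae : ∀ i, AEMeasurable (fun y : M → ℝ => y i) μ := fun i =>
      (measurable_pi_apply i).aemeasurable
    have hlaw : ∀ i, HasGaussianLaw (fun y : M → ℝ => y i) μ := fun i =>
      ⟨by rw [heval]; infer_instance⟩
    have hind : iIndepFun (fun (i : M) (y : M → ℝ) => y i) μ :=
      iIndepFun_infinitePi (X := fun _ x => x) fun _ => measurable_id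
    have hproc : IsGaussianProcess (fun (i : M) (y : M → ℝ) => y i) μ := by
      refine ⟨fun I => ?_⟩
      exact iIndepFun.hasGaussianLaw (fun i : I => hlaw i)
        (hind.precomp (g := fun i : I => (i : M)) Subtype.val_injective)
    have hmean : ∀ i, ∫ y : M → ℝ, y i ∂μ = f i := by
      intro i
      have := integral_map (μ := μ) (φ := fun y : M → ℝ => y i) (hae i)
        (f := id) (by fun_prop)
      rw [heval] at this
      simpa using this.symm
    have hcov : ∀ i l, cov[fun y : M → ℝ => y i, fun y => y l; μ]
        = inner ℝ ((√n)⁻¹ • (lp.single 2 i (1 : ℝ) : lp (fun _ : M => ℝ) 2))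
          ((√n)⁻¹ • (lp.single 2 l (1 : ℝ) : lp (fun _ : M => ℝ) 2)) := by
      intro i l
      rw [real_inner_smul_left, real_inner_smul_right, lp.inner_single_right, lp.single_apply]
      rcases eq_or_ne i l with rfl | hil
      · have hv : Var[fun y : M → ℝ => y i; μ] = 1 / n := by
          rw [← variance_id_map (hae i), heval, variance_id_gaussianReal,
            Real.coe_toNNReal _ (by positivity)]
        rw [covariance_self (hae i), hv]
        simp only [Pi.single_eq_same]
        rw [← mul_assoc, ← mul_inv, Real.mul_self_sqrt hn.le]
        simp
      · rw [(hind.indepFun hil).covariance_eq_zero (hlaw i).memLp_two (hlaw l).memLp_two]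
        simp [Pi.single_eq_of_ne hil.symm]
    have := hproc.hasGaussianFieldLaw (fun i => measurable_pi_apply i) hmean hcov 0
    simpa using this

end SequenceModel

/-! ### The white noise model -/

section WhiteNoise

lemma timeMeasure_image {A : Set TimeInterval} :
    timeMeasure A = volume (Subtype.val '' A) :=
  (MeasurableEmbedding.subtype_coe measurableSet_Icc).comap_apply _ _

instance isFiniteMeasure_timeMeasure : IsFiniteMeasure timeMeasure := by
  refine ⟨?_⟩
  rw [timeMeasure_image]
  exact (measure_mono (Subtype.coe_image_subset _ _)).trans_lt measure_Icc_lt_top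

lemma timeMeasure_real_Iic (t : TimeInterval) :
    timeMeasure.real (Set.Iic t) = (t : ℝ) + 1 / 2 := by
  have : (Subtype.val '' Set.Iic t : Set ℝ) = Set.Icc (-(1 / 2)) (t : ℝ) := by
    ext x
    constructor
    · rintro ⟨s, hs, rfl⟩
      exact ⟨s.2.1, hs⟩
    · rintro ⟨h1, h2⟩
      exact ⟨⟨x, h1, h2.trans t.2.2⟩, h2, rfl⟩
  rw [measureReal_def, timeMeasure_image, this, Real.volume_Icc, ENNReal.toReal_ofReal]
  · ring
  · linarith [t.2.1]

/-- The element of `L²` that represents the observation of the path at time `t`. -/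
noncomputable def timeIndicator (t : TimeInterval) : Lp ℝ 2 timeMeasure :=
  indicatorConstLp 2 (measurableSet_Iic (a := t)) (measure_ne_top _ _) (1 : ℝ)

lemma inner_timeIndicator (s t : TimeInterval) :
    inner ℝ (timeIndicator s) (timeIndicator t) = min (s : ℝ) t + 1 / 2 := by
  rw [timeIndicator, timeIndicator, L2.real_inner_indicatorConstLp_one_indicatorConstLp_one,
    Set.Iic_inter_Iic, timeMeasure_real_Iic]
  rfl

lemma functionNorm_smul_le (r : ℝ) (x : TimeInterval → ℝ) :
    functionNorm (r • x) ≤ ENNReal.ofReal |r| * functionNorm x := by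
  rw [functionNorm, functionNorm, eLpNorm_const_smul, Real.enorm_eq_ofReal_abs]

/-- The indicators of `[-1/2, t]` have inner products `min s t + 1/2`, the covariance of Brownian
motion started at `-1/2`. Again `u = √n (g - f)`; the drifts are merely integrable, and finiteness
of the norm puts their difference in `L²`. -/
lemma isGaussianModel_whiteNoise {Ω : Type*} [MeasurableSpace Ω] {P : Measure Ω}
    {W : ℝ≥0 → Ω → ℝ} (hWm : ∀ t, Measurable (W t)) (hW : IsBrownianReal W P) {n : ℝ}
    (hn : 0 < n) :
    IsGaussianModel {f : TimeInterval → ℝ | Integrable f timeMeasure}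
      (fun t => (√n)⁻¹ • timeIndicator t) (fun f t => ∫ s in Set.Iic t, f s ∂timeMeasure) n
      functionNorm (whiteNoiseLaw P n W) where
  norm_smul_le := functionNorm_smul_le
  exists_shift f hf g hg ε hε h := by
    have hf' : Integrable f timeMeasure := hf
    have hg' : Integrable g timeMeasure := hg
    have hmem : MemLp (g - f) 2 timeMeasure :=
      ⟨(hg'.sub hf').aestronglyMeasurable, h.trans_lt ENNReal.ofReal_lt_top⟩
    have hsn : 0 < √n := Real.sqrt_pos.2 hn
    refine ⟨√n • hmem.toLp (g - f), ?_, fun t => ?_⟩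
    · rw [norm_smul, Real.norm_of_nonneg hsn.le, Lp.norm_toLp]
      gcongr
      exact ENNReal.toReal_le_of_le_ofReal hε h
    · rw [real_inner_smul_left, real_inner_smul_right, real_inner_comm, timeIndicator,
        L2.inner_indicatorConstLp_one, mul_inv_cancel_left₀ hsn.ne',
        setIntegral_congr_ae measurableSet_Iic
          (hmem.coeFn_toLp.mono fun _ hx _ => hx)]
      exact (integral_sub hg'.integrableOn hf'.integrableOn).symm
  hasGaussianFieldLaw f _ := by
    have hsn : 0 < √n := Real.sqrt_pos.2 hn
    have hproc : IsGaussianProcess (fun (t : TimeInterval) ω =>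
        (√n)⁻¹ * W (Real.toNNReal ((t : ℝ) + 1 / 2)) ω) P :=
      (hW.isGaussianProcess.comp_right fun t : TimeInterval =>
        Real.toNNReal ((t : ℝ) + 1 / 2)).smul fun _ => (√n)⁻¹
    have hmean : ∀ t : TimeInterval,
        ∫ ω, (√n)⁻¹ * W (Real.toNNReal ((t : ℝ) + 1 / 2)) ω ∂P = 0 := by
      intro t
      rw [integral_const_mul, hW.integral_eval, mul_zero]
    have hcov : ∀ s t : TimeInterval, cov[fun ω => (√n)⁻¹ * W (Real.toNNReal ((s : ℝ) + 1 / 2)) ω,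
        fun ω => (√n)⁻¹ * W (Real.toNNReal ((t : ℝ) + 1 / 2)) ω; P]
        = inner ℝ ((√n)⁻¹ • timeIndicator s) ((√n)⁻¹ • timeIndicator t) := by
      intro s t
      have hs : 0 ≤ (s : ℝ) + 1 / 2 := by linarith [s.2.1]
      have ht : 0 ≤ (t : ℝ) + 1 / 2 := by linarith [t.2.1]
      rw [covariance_const_mul_left, covariance_const_mul_right, hW.covariance_fun_eval,
        real_inner_smul_left, real_inner_smul_right, inner_timeIndicator, NNReal.coe_min,
        Real.coe_toNNReal _ hs, Real.coe_toNNReal _ ht, min_add_add_right]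
    have := hproc.hasGaussianFieldLaw (fun t => (hWm _).const_mul _) hmean hcov
      (fun t => ∫ s in Set.Iic t, f s ∂timeMeasure)
    simp only [add_zero] at this
    exact this

end WhiteNoise


theorem proposition4 {k : ℕ} (n : ℝ) (hn : 0 < n) (α : ℝ) (hα₀ : 0 < α) (hα : α < 1 / 2) :
    -- the white noise model
    (∀ {Ω : Type*} [MeasurableSpace Ω] (P : Measure Ω) [IsProbabilityMeasure P]
      (W : ℝ≥0 → Ω → ℝ) (_ : ∀ t, Measurable (W t)) (_ : IsBrownianReal W P)
      (T : (TimeInterval → ℝ) →ₗ[ℝ] ℝ) (F : Fin k → Set (TimeInterval → ℝ))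
      (_ : ∀ i, ∀ f ∈ F i, Integrable f timeMeasure)
      (_ : ∀ i, Convex ℝ (F i)) (_ : ∀ i l, (F i ∩ F l).Nonempty)
      (G : Set (TimeInterval → ℝ)) (_ : G = ⋃ i, F i)
      (w : Fin k → Fin k → ℝ)
      (_ : ∀ i l, w i l =
        orderedModulus functionNorm T (normalQuantile (α / 2) / √n) (F i) (F l))
      (That : Fin k → Fin k → (TimeInterval → ℝ) → ℝ) (j : Fin k)
      (_ : ∀ i l, i = j ∨ l = j →
        BddAbove (modulusSet functionNorm T (normalQuantile (α / 2) / √n) (F i) (F l)))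
      (_ : ∀ i l, i = j ∨ l = j →
        IsBalancedEstimator (whiteNoiseLaw P n W) T α G (w i l) (F i) (F l) (That i l)),
      adaptiveInterval That w j ∈ confidenceIntervals (whiteNoiseLaw P n W) T α G ∧
      optimalExpectedLength (whiteNoiseLaw P n W) T α (F j) G
        ≤ maxExpectedLength (whiteNoiseLaw P n W) (adaptiveInterval That w j) (F j) ∧
      maxExpectedLength (whiteNoiseLaw P n W) (adaptiveInterval That w j) (F j)
        ≤ ENNReal.ofReal (lengthFactor k α)
          * optimalExpectedLength (whiteNoiseLaw P n W) T α (F j) G) ∧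
    -- the sequence model
    (∀ {M : Type*} [Countable M]
      (T : (M → ℝ) →ₗ[ℝ] ℝ) (F : Fin k → Set (M → ℝ))
      (_ : ∀ i, Convex ℝ (F i)) (_ : ∀ i l, (F i ∩ F l).Nonempty)
      (G : Set (M → ℝ)) (_ : G = ⋃ i, F i)
      (w : Fin k → Fin k → ℝ)
      (_ : ∀ i l, w i l =
        orderedModulus sequenceNorm T (normalQuantile (α / 2) / √n) (F i) (F l))
      (That : Fin k → Fin k → (M → ℝ) → ℝ) (j : Fin k)
      (_ : ∀ i l, i = j ∨ l = j →
        BddAbove (modulusSet sequenceNorm T (normalQuantile (α / 2) / √n) (F i) (F l)))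
      (_ : ∀ i l, i = j ∨ l = j →
        IsBalancedEstimator (sequenceLaw n) T α G (w i l) (F i) (F l) (That i l)),
      adaptiveInterval That w j ∈ confidenceIntervals (sequenceLaw n) T α G ∧
      optimalExpectedLength (sequenceLaw n) T α (F j) G
        ≤ maxExpectedLength (sequenceLaw n) (adaptiveInterval That w j) (F j) ∧
      maxExpectedLength (sequenceLaw n) (adaptiveInterval That w j) (F j)
        ≤ ENNReal.ofReal (lengthFactor k α)
          * optimalExpectedLength (sequenceLaw n) T α (F j) G) := by
  refine ⟨?_, ?_⟩
  · intro Ω _ P _ W hWm hW T F hF hconv hne G hG w hw That j hbdd hThat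
    refine (isGaussianModel_whiteNoise hWm hW hn).adaptiveInterval_optimal hn hα₀ hα ?_ hconv hne
      hG hw hbdd hThat
    rw [hG]
    exact Set.iUnion_subset fun i f hf => hF i f hf
  · intro M _ T F hconv hne G hG w hw That j hbdd hThat
    classical
    exact (isGaussianModel_sequence hn).adaptiveInterval_optimal hn hα₀ hα (Set.subset_univ G)
      hconv hne hG hw hbdd hThat
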